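/- Let $S$ be a normal integral scheme and let $A$ be an $n$-dimensional $\mathbb{G}_{a,S}$-algebra scheme with $n\ge 2$, i.e. a unitary associative (not necessarily commutative) algebra scheme over the structure ring scheme $\mathbb{G}_{a,S}$ whose underlying module scheme is a vector bundle of rank $n$ over $S$. Let $d$ be the least integer such that the morphism $A\to\wedge^{d+1}A$, $a\mapsto 1\wedge a\wedge\dots\wedge a^d$, is zero. The determinant $\det_{A/S}$ of $A$ is the unique section of $\mathrm{Sym}^d(A^\vee)$ (that is, the unique function on $A$ that is homogeneous of degree $d$ in linear coordinates) such that 1. $\det_{A/S}\colon A\to\mathbb{G}_{a,S}$ is a morphism of multiplicative unitary monoid schemes, and 2. the morphism $A\to A$ obtained by evaluating at $a\in A$ the polynomial $P(T)=\det_{A/S}(T-a)$ is zero. Let $A^\circ\to S$ be the opposite algebra scheme: the same vector bundle and unit, with multiplication $a\star_{A^\circ}b=b\star_A a$. Then $A$ and $A^\circ$ both have a determinant in this sense (each exists and is unique), and, as functions on the common underlying scheme, $\det_{A^\circ/S}=\det_{A/S}$. -/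

import Mathlib

open CategoryTheory AlgebraicGeometry

universe u

/-- A (unitary, associative, not necessarily commutative) algebra scheme over the structure ring
scheme `𝔾ₐ` of `S`: an `S`-scheme `X` together with, for every `S`-scheme `T`, the structure of a
`Γ(T, 𝒪_T)`-algebra on the set `X(T)` of `T`-valued points, functorially in `T`.
(Recall `𝔾ₐ(T) = Γ(T, 𝒪_T)`; by Yoneda this is the same as giving the structure morphisms
`X × X ⟶ X`, `𝔾ₐ × X ⟶ X`, … subject to the usual identities.) -/
structure GaAlgebraScheme (S : Scheme.{u}) where
  /-- the underlying `S`-scheme -/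
  X : Over S
  /-- the ring of `T`-valued points -/
  ring : ∀ T : Over S, Ring (T ⟶ X)
  /-- the action of `𝔾ₐ(T) = Γ(T, 𝒪_T)` on `T`-valued points -/
  algebra : ∀ T : Over S, Algebra Γ(T.left, ⊤) (T ⟶ X)
  comp_add : ∀ {T T' : Over S} (g : T' ⟶ T) (a b : T ⟶ X), g ≫ (a + b) = g ≫ a + g ≫ b
  comp_mul : ∀ {T T' : Over S} (g : T' ⟶ T) (a b : T ⟶ X), g ≫ (a * b) = (g ≫ a) * (g ≫ b)
  comp_one : ∀ {T T' : Over S} (g : T' ⟶ T), g ≫ (1 : T ⟶ X) = 1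
  comp_smul : ∀ {T T' : Over S} (g : T' ⟶ T) (c : Γ(T.left, ⊤)) (a : T ⟶ X),
    g ≫ (c • a) = (g.left.appTop.hom c : Γ(T'.left, ⊤)) • (g ≫ a)

namespace GaAlgebraScheme

variable {S : Scheme.{u}}

/-- The `T`-valued points of an algebra scheme. -/
def Pt (A : GaAlgebraScheme S) (T : Over S) : Type u := T ⟶ A.X

instance instRingPt (A : GaAlgebraScheme S) (T : Over S) : Ring (A.Pt T) := A.ring T

instance instAlgebraPt (A : GaAlgebraScheme S) (T : Over S) : Algebra Γ(T.left, ⊤) (A.Pt T) :=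
  A.algebra T

/-- Pullback of a `T`-valued point along `g : T' ⟶ T`. -/
def Pt.pull {A : GaAlgebraScheme S} {T T' : Over S} (a : A.Pt T) (g : T' ⟶ T) : A.Pt T' :=
  (g ≫ (show T ⟶ A.X from a) : T' ⟶ A.X)

/-- The value `δ(a) ∈ Γ(T, 𝒪_T)` of a function `δ : A ⟶ 𝔾ₐ` (that is, of a global function on the
scheme underlying `A`) at a `T`-valued point `a` of `A`. -/
def Pt.val {A : GaAlgebraScheme S} {T : Over S} (a : A.Pt T) (δ : Γ(A.X.left, ⊤)) :
    Γ(T.left, ⊤) :=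
  (show T ⟶ A.X from a).left.appTop.hom δ

/-- The sections `e₁, …, eₙ` of `A` over the open subscheme `U` of `S` form a basis of `A` over `U`:
`(x₁, …, xₙ) ↦ x₁ e₁ + ⋯ + xₙ eₙ` is an isomorphism from `𝔾ₐⁿ` to `A` over `U`. -/
def IsBasisOver (A : GaAlgebraScheme S) (U : S.Opens) {n : ℕ}
    (e : Fin n → A.Pt (Over.mk U.ι)) : Prop :=
  ∀ (T : Over S) (g : T ⟶ Over.mk U.ι) (a : A.Pt T),
    ∃! x : Fin n → Γ(T.left, ⊤), a = ∑ i, x i • (e i).pull g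

/-- `A` is an `n`-dimensional algebra scheme: the underlying `𝔾ₐ`-module scheme is a vector bundle
of rank `n`, i.e. Zariski-locally on `S` it is isomorphic to `𝔾ₐⁿ`. -/
def IsOfDim (A : GaAlgebraScheme S) (n : ℕ) : Prop :=
  ∀ s : S, ∃ (U : S.Opens) (e : Fin n → A.Pt (Over.mk U.ι)), s ∈ U ∧ A.IsBasisOver U e

/-- The morphism `A ⟶ ⋀ᵐ⁺¹ A`, `a ↦ 1 ∧ a ∧ ⋯ ∧ aᵐ`, is the zero morphism. (A morphism to a
vector bundle is zero as soon as it is zero on points with values in affine schemes, and for affine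
`T` the `T`-points of `⋀ᵐ⁺¹ A` are the exterior power of the `Γ(T, 𝒪_T)`-module `A(T)`.) -/
def DegLE (A : GaAlgebraScheme S) (m : ℕ) : Prop :=
  ∀ (T : Over S) [IsAffine T.left] (a : A.Pt T),
    exteriorPower.ιMulti Γ(T.left, ⊤) (m + 1) (fun i : Fin (m + 1) => a ^ (i : ℕ)) = 0

/-- The least integer `d` such that `a ↦ 1 ∧ a ∧ ⋯ ∧ aᵈ` is the zero morphism. -/
noncomputable def deg (A : GaAlgebraScheme S) : ℕ := sInf {m : ℕ | A.DegLE m}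

/-- The function `δ` on the vector bundle `A` is a section of `Symᵐ(A^∨)`. Over an affine open `U`
on which `A` has a basis `e₁, …, eₙ`, with dual basis the coordinates `t₁, …, tₙ`, one has
`A|_U = Spec Γ(U, 𝒪)[t₁, …, tₙ]`, and `Symᵐ(A^∨)` consists of the
homogeneous polynomials of degree `m` in `t₁, …, tₙ`. -/
def IsSymSection (A : GaAlgebraScheme S) (m : ℕ) (δ : Γ(A.X.left, ⊤)) : Prop :=
  ∀ (U : S.Opens), IsAffineOpen U → ∀ (n : ℕ) (e : Fin n → A.Pt (Over.mk U.ι)),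
    A.IsBasisOver U e →
    ∃ F : MvPolynomial (Fin n) Γ((Over.mk U.ι).left, ⊤), F.IsHomogeneous m ∧
      ∀ (T : Over S) (g : T ⟶ Over.mk U.ι) (x : Fin n → Γ(T.left, ⊤)),
        (∑ i, x i • (e i).pull g : A.Pt T).val δ = F.eval₂ g.left.appTop.hom x

/-- `δ : A ⟶ 𝔾ₐ` is a morphism of multiplicative unitary monoid schemes. -/
def IsMonoidHom (A : GaAlgebraScheme S) (δ : Γ(A.X.left, ⊤)) : Prop :=
  ∀ T : Over S, (1 : A.Pt T).val δ = 1 ∧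
    ∀ a b : A.Pt T, (a * b).val δ = a.val δ * b.val δ

/-- The affine line `Spec Γ(T, 𝒪_T)[X]` over an affine `S`-scheme `T`. -/
noncomputable def line (T : Over S) [IsAffine T.left] : Over S :=
  Over.mk (Spec.map (CommRingCat.ofHom
    (Polynomial.C : Γ(T.left, ⊤) →+* Polynomial Γ(T.left, ⊤))) ≫ T.left.isoSpec.inv ≫ T.hom)

/-- The projection from the affine line over `T` to `T`. -/
noncomputable def lineProj (T : Over S) [IsAffine T.left] : line T ⟶ T :=
  Over.homMk (Spec.map (CommRingCat.ofHom
    (Polynomial.C : Γ(T.left, ⊤) →+* Polynomial Γ(T.left, ⊤))) ≫ T.left.isoSpec.inv)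
    (by simp [line])

/-- The identification of the ring of functions on the affine line over `T` with the polynomial
ring over `Γ(T, 𝒪_T)`. -/
noncomputable def lineFun (T : Over S) [IsAffine T.left] :
    Γ((line T).left, ⊤) ≃+* Polynomial Γ(T.left, ⊤) :=
  (Scheme.ΓSpecIso (CommRingCat.of (Polynomial Γ(T.left, ⊤)))).commRingCatIsoToRingEquiv

/-- The polynomial `δ(X - a)` with coefficients in `Γ(T, 𝒪_T)`, where `a` is a point of `A` with
values in an affine `T` and the indeterminate `X` is a scalar over the affine line over `T`. -/
noncomputable def charPoly (A : GaAlgebraScheme S) (δ : Γ(A.X.left, ⊤)) (T : Over S)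
    [IsAffine T.left] (a : A.Pt T) : Polynomial Γ(T.left, ⊤) :=
  lineFun T ((algebraMap Γ((line T).left, ⊤) (A.Pt (line T)) ((lineFun T).symm Polynomial.X) -
    a.pull (lineProj T)).val δ)

/-- `δ` has the properties that characterize the determinant of `A` over `S`: it is a section of
`Symᵈ(A^∨)`, where `d` is the least integer such that `a ↦ 1 ∧ a ∧ ⋯ ∧ aᵈ` is zero;
`δ : A ⟶ 𝔾ₐ` is a morphism of multiplicative unitary monoid schemes; and the morphism
`A ⟶ A` evaluating at `a` the polynomial `P(X) = δ(X - a)` is zero. -/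
structure IsDeterminant (A : GaAlgebraScheme S) (δ : Γ(A.X.left, ⊤)) : Prop where
  isSymSection : A.IsSymSection A.deg δ
  isMonoidHom : A.IsMonoidHom δ
  aeval_charPoly : ∀ (T : Over S) [IsAffine T.left] (a : A.Pt T),
    Polynomial.aeval a (A.charPoly δ T a) = 0

open Classical in
/-- The determinant `det_{A/S} : A ⟶ 𝔾ₐ`: the function on `A` with the characterizing properties
`IsDeterminant` (and, by convention, `0` if there is none). -/
noncomputable def det (A : GaAlgebraScheme S) : Γ(A.X.left, ⊤) :=
  if h : ∃ δ : Γ(A.X.left, ⊤), A.IsDeterminant δ then h.choose else 0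

/-- The opposite ring structure on a ring: same addition and unit, and `a ⋆ b = b * a`. -/
abbrev opRing {R : Type*} (i : Ring R) : Ring R :=
  { i with
    mul := fun a b => b * a
    mul_assoc := fun a b c => (mul_assoc c b a).symm
    one_mul := fun a => mul_one a
    mul_one := fun a => one_mul a
    left_distrib := fun a b c => add_mul b c a
    right_distrib := fun a b c => mul_add c a b
    zero_mul := fun a => mul_zero a
    mul_zero := fun a => zero_mul a
    npow := fun k a => a ^ k
    npow_zero := fun a => pow_zero a
    npow_succ := fun k a => pow_succ' a k }

/-- The algebra structure on the opposite ring, with unchanged scalar multiplication. -/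
abbrev opAlgebra {k R : Type*} [CommRing k] (i : Ring R) (j : Algebra k R) :
    @Algebra k R _ (opRing i).toSemiring :=
  @Algebra.mk k R _ (opRing i).toSemiring ⟨fun c a => c • a⟩
    (@RingHom.mk k R _ (opRing i).toNonAssocSemiring
      (@MonoidHom.mk k R _ (opRing i).toMulOneClass.toMulOne ⟨fun c => algebraMap k R c, map_one _⟩
        fun a b => (map_mul (algebraMap k R) a b).trans (Algebra.commutes a _))
      (map_zero (algebraMap k R)) (map_add (algebraMap k R)))
    (fun c a => (Algebra.commutes c a).symm)
    (fun c a => (Algebra.smul_def c a).trans (Algebra.commutes c a))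

/-- The opposite algebra scheme `A°`: the same scheme, with the same addition, unit and scalar
multiplication, and with `a ⋆ b = b * a`. -/
def op (A : GaAlgebraScheme S) : GaAlgebraScheme S where
  X := A.X
  ring T := opRing (A.ring T)
  algebra T := @opAlgebra _ _ _ (A.ring T) (A.algebra T)
  comp_add := A.comp_add
  comp_mul := fun g a b => A.comp_mul g b a
  comp_one := A.comp_one
  comp_smul := A.comp_smul

end GaAlgebraScheme

/-!
The determinant of `A` is the reduced norm, obtained from the minimal polynomial of the generic
element. Let `K` be the function field of `S`, and let `ξ = t₁ e₁ + ⋯ + tₙ eₙ` be the generic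
element of `A` over `K`, represented by the matrix of left multiplication with entries in `K[t]`.
As `K[t]` is integrally closed, `ξ` has a monic minimal polynomial `P` over `K[t]`, of degree `d` say. The
generic determinant is `F = (-1)ᵈ P(0) ∈ K[t]` (`GenericElement.genericDet`).

* A monic polynomial of degree `d` over `K[t][X]` that annihilates `α + β ξ`, with `α, β ∈ K[t][X]`
  and `β ≠ 0`, is the one obtained from `P` by the affine substitution, because `ξ` satisfies no
  polynomial of degree less than `d` over `K[t][X]` either (`comp_linear_eq_of_minimal`). Applied
  to specializations of `P`, with `X ξ` this shows that `F` is homogeneous of degree `d`, and with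
  `X - ξ` that `F(X - ξ) = P`; so `F(X - ξ)` annihilates `ξ`, and `F` is `1` at the unit.
  Conversely a homogeneous `F` of degree `d` that is `1` at the unit and such that `F(X - ξ)`
  annihilates `ξ` has `F(X - ξ) = P`, so it is the generic determinant (`eq_genericDet`).
* `P` divides the characteristic polynomial, so `F` divides the norm `N = det ξ`. Thus `F(st)`
  divides `N(s) N(t)` for independent generic elements `s`, `t`; as `K[s, t]` is factorial, `F(st)`
  has the form `a(s) b(t)`, and putting `s = 1` or `t = 1` gives `F(st) = F(s) F(t)`
  (`eval₂_mulVec_of_dvd_det`).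
* The coefficients of `P` are integral over those of the characteristic polynomial. Since `S` is
  normal, `F` has coefficients in `Γ(U, 𝒪)` for every affine open `U` with a basis of `A` over `U`
  (`exists_map_eq_genericDet`). It does not depend on the basis, so these polynomials glue to
  a function `δ` on `A` (`exists_isLocallyGenericDet`), and identities between polynomials pass from
  `K` to `Γ(U, 𝒪)` and from there to points of `A` with values in any `S`-scheme.
* As `δ(X - a)` is monic of degree `d` and annihilates `a`, the product `1 ∧ a ∧ ⋯ ∧ aᵈ` vanishes.
  For `m < d` the powers `1, ξ, …, ξᵐ` are linearly independent over `Γ(U, 𝒪)[t]`, so their exterior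
  product is not zero. Hence `d` is the integer `A.deg` (`deg_eq_degree`), and `δ` is a determinant.
  Uniqueness follows from `eq_genericDet` at the universal point of `A` over `U`.

The powers of an element, the scalars and the underlying vector bundle are the same for the opposite
algebra scheme, and the multiplication of functions is commutative. So a determinant of `A` is also
one of `A.op`, and uniqueness for `A.op` gives the equality of the two.
-/

/-! ### Generic elements and minimal polynomials of matrices -/

namespace GenericElement

open Polynomial

section EvalAt

variable {σ ι R B B' : Type*} [Fintype σ]
  [CommRing R] [CommRing B] [CommRing B']

/-- The linear combination of the matrices `M i` with coefficients `x i` in an `R`-algebra `B`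
(with structure map `φ`). -/
def evalAt (φ : R →+* B) (M : σ → Matrix ι ι R) (x : σ → B) : Matrix ι ι B :=
  ∑ i, x i • (M i).map φ

/-- The generic linear combination of the matrices `M i`, whose coefficients are indeterminates. -/
noncomputable def generic (M : σ → Matrix ι ι R) : Matrix ι ι (MvPolynomial σ R) :=
  evalAt MvPolynomial.C M MvPolynomial.X

lemma evalAt_map (φ : R →+* B) (θ : B →+* B') (M : σ → Matrix ι ι R) (x : σ → B) :
    (evalAt φ M x).map θ = evalAt (θ.comp φ) M (fun i => θ (x i)) := by
  ext a b
  simp [evalAt, Matrix.sum_apply]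

lemma evalAt_map_family (φ : R →+* B) (θ : B →+* B') (M : σ → Matrix ι ι R) (x : σ → B') :
    evalAt θ (fun i => (M i).map φ) x = evalAt (θ.comp φ) M x := by
  ext a b
  simp [evalAt, Matrix.sum_apply]

lemma generic_map_eval₂Hom (φ : R →+* B) (M : σ → Matrix ι ι R) (x : σ → B) :
    (generic M).map (MvPolynomial.eval₂Hom φ x) = evalAt φ M x := by
  rw [generic, evalAt_map]
  congr 1
  · ext; simp
  · ext; simp

lemma generic_map_map (φ : R →+* B) (M : σ → Matrix ι ι R) :
    (generic M).map (MvPolynomial.map φ) = generic (fun i => (M i).map φ) := by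
  rw [generic, evalAt_map, generic, evalAt_map_family]
  congr 1
  · ext; simp
  · ext; simp

end EvalAt

section Minimal

variable {ι D : Type*} [Fintype ι] [DecidableEq ι] [CommRing D]

lemma map_aeval_matrix {B : Type*} [CommRing B] (θ : D →+* B) (N : Matrix ι ι D) (p : D[X]) :
    (aeval N p).map θ = aeval (N.map θ) (p.map θ) := by
  rw [aeval_def, aeval_def, eval₂_map]
  change θ.mapMatrix _ = _
  rw [Polynomial.hom_eval₂]
  congr 1
  ext1 a
  simp only [RingHom.comp_apply, RingHom.mapMatrix_apply, Matrix.algebraMap_eq_diagonal]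
  ext i j
  simp [Matrix.diagonal_apply, apply_ite θ]

/-- A matrix over an integrally closed domain has a monic minimal polynomial, which divides the
characteristic polynomial. -/
lemma exists_monic_minimal [IsDomain D] [IsIntegrallyClosed D] (N : Matrix ι ι D) :
    ∃ P : D[X], P.Monic ∧ aeval N P = 0 ∧ P ∣ N.charpoly ∧
      ∀ q : D[X], aeval N q = 0 → q.degree < P.degree → q = 0 := by
  set L := FractionRing D
  set θ := algebraMap D L
  have hθ : Function.Injective θ := IsFractionRing.injective D L
  have hint : IsIntegral L (N.map θ) := Algebra.IsIntegral.isIntegral _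
  have hdvd : minpoly L (N.map θ) ∣ N.charpoly.map θ := by
    rw [← Matrix.charpoly_map]
    exact minpoly.dvd _ _ (Matrix.aeval_self_charpoly _)
  obtain ⟨P, hP⟩ := IsIntegrallyClosed.eq_map_mul_C_of_dvd L N.charpoly_monic hdvd
  rw [(minpoly.monic hint).leadingCoeff, C_1, mul_one] at hP
  have hPm : P.Monic := by
    refine monic_of_injective hθ ?_
    rw [hP]; exact minpoly.monic hint
  have hdeg : P.degree = (minpoly L (N.map θ)).degree := by
    rw [← hP, degree_map_eq_of_injective hθ]
  refine ⟨P, hPm, ?_, ?_, ?_⟩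
  · have : (aeval N P).map θ = 0 := by
      rw [map_aeval_matrix, hP, minpoly.aeval]
    refine Matrix.map_injective hθ (?_ : (aeval N P).map θ = (0 : Matrix ι ι D).map θ)
    rw [this]; ext; simp
  · rw [← Polynomial.map_dvd_map θ hθ hPm, hP]
    exact hdvd
  · intro q hq hlt
    have h0 : aeval (N.map θ) (q.map θ) = 0 := by
      rw [← map_aeval_matrix, hq]; ext; simp
    by_contra hne
    have hne' : q.map θ ≠ 0 := (Polynomial.map_ne_zero_iff hθ).2 hne
    have := minpoly.degree_le_of_ne_zero L (N.map θ) hne' h0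
    rw [degree_map_eq_of_injective hθ, ← hdeg] at this
    exact absurd hlt (not_lt.2 this)

/-- If no nonzero polynomial of degree less than `d` over `D` annihilates `N`, then none does
over `D[X]` either: the coefficients of powers of the new variable can be compared. -/
lemma eq_zero_of_aeval_map_C_eq_zero (N : Matrix ι ι D) (d : WithBot ℕ)
    (h : ∀ q : D[X], aeval N q = 0 → q.degree < d → q = 0)
    (q : D[X][X]) (hq : aeval (N.map C) q = 0) (hd : q.degree < d) : q = 0 := by
  have key : ∀ k, (∑ j ∈ q.support, monomial j ((q.coeff j).coeff k) : D[X]) = 0 := by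
    intro k
    apply h
    · ext a b
      have h1 := congrArg (fun Z : Matrix ι ι D[X] => (Z a b).coeff k) hq
      simp only [aeval_eq_sum_range, Matrix.sum_apply, Matrix.smul_apply, Matrix.zero_apply,
        coeff_zero, finsetSum_coeff, smul_eq_mul] at h1
      have h2 : ∀ j, (N.map (C : D →+* D[X])) ^ j = (N ^ j).map C := by
        intro j
        exact ((C : D →+* D[X]).mapMatrix.map_pow N j).symm
      rw [map_sum, Matrix.sum_apply, Matrix.zero_apply, ← h1]
      simp only [h2, Matrix.map_apply, coeff_mul_C, aeval_monomial, Algebra.algebraMap_eq_smul_one,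
        smul_mul_assoc, one_mul, Matrix.smul_apply, smul_eq_mul]
      refine Finset.sum_subset (fun j hj => ?_) (fun j _ hj => ?_)
      · exact Finset.mem_range.2 (Nat.lt_succ_of_le (le_natDegree_of_mem_supp j hj))
      · simp [notMem_support_iff.1 hj]
    · refine (degree_sum_le _ _).trans_lt ?_
      rcases Finset.eq_empty_or_nonempty q.support with h0 | h0
      · rw [h0, Finset.sup_empty]
        exact bot_le.trans_lt hd
      · refine (Finset.sup_lt_iff (bot_le.trans_lt hd)).2 fun j hj => ?_
        exact (degree_monomial_le _ _).trans_lt ((le_degree_of_mem_supp j hj).trans_lt hd)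
  ext j k
  have := congrArg (fun p : D[X] => p.coeff j) (key k)
  simp only [finsetSum_coeff, coeff_monomial, coeff_zero] at this
  rw [Finset.sum_ite_eq'] at this
  split_ifs at this with hj
  · simpa using this
  · simp [notMem_support_iff.1 hj]

end Minimal

end GenericElement

/-! ### The polynomial `F(X u - x)` -/

namespace GenericElement

open Polynomial

section Homogeneous

variable {σ R B : Type*} [CommRing R] [CommRing B]

lemma eval₂_mul_of_isHomogeneous {F : MvPolynomial σ R} {d : ℕ} (hF : F.IsHomogeneous d)
    (φ : R →+* B) (r : B) (x : σ → B) :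
    F.eval₂ φ (fun i => r * x i) = r ^ d * F.eval₂ φ x := by
  rw [MvPolynomial.eval₂_eq, MvPolynomial.eval₂_eq, Finset.mul_sum]
  refine Finset.sum_congr rfl fun m hm => ?_
  have hd : ∑ i ∈ m.support, m i = d := (hF.degree_eq_sum_deg_support hm).symm
  simp only [mul_pow, Finset.prod_mul_distrib, Finset.prod_pow_eq_pow_sum, hd]
  ring

/-- A polynomial `F` with `F(X t) = X ^ d F(t)`, where `X` is a new variable, is homogeneous of
degree `d`. -/
lemma isHomogeneous_of_eval₂_X_mul {F : MvPolynomial σ R} {d : ℕ}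
    (h : F.eval₂ ((C : _ →+* (MvPolynomial σ R)[X]).comp MvPolynomial.C)
      (fun i => X * C (MvPolynomial.X i)) = X ^ d * C F) : F.IsHomogeneous d := by
  set φ : R →+* (MvPolynomial σ R)[X] := C.comp MvPolynomial.C with hφ
  have hC : ∀ G : MvPolynomial σ R, G.eval₂ φ (fun i => C (MvPolynomial.X i)) = C G := by
    intro G
    have := MvPolynomial.hom_eval₂ G (MvPolynomial.C : R →+* MvPolynomial σ R)
      (C : _ →+* (MvPolynomial σ R)[X]) MvPolynomial.X
    rw [MvPolynomial.eval₂_eta] at this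
    exact this.symm
  have hsum : F.eval₂ φ (fun i => X * C (MvPolynomial.X i)) =
      ∑ k ∈ Finset.range (F.totalDegree + 1),
        X ^ k * C (MvPolynomial.homogeneousComponent k F) := by
    conv_lhs => rw [← MvPolynomial.sum_homogeneousComponent F]
    rw [MvPolynomial.eval₂_sum]
    refine Finset.sum_congr rfl fun k _ => ?_
    rw [eval₂_mul_of_isHomogeneous (MvPolynomial.homogeneousComponent_isHomogeneous k F), hC]
  rw [hsum] at h
  have h2 := congrArg (fun p : (MvPolynomial σ R)[X] => p.coeff d) h
  simp only [finsetSum_coeff, coeff_mul_C, coeff_X_pow, ite_mul, one_mul, zero_mul,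
    Finset.sum_ite_eq, ↓reduceIte] at h2
  split_ifs at h2 with hd
  · rw [← h2]
    exact MvPolynomial.homogeneousComponent_isHomogeneous d F
  · rw [← h2]
    exact MvPolynomial.isHomogeneous_zero _ _ _

/-- The polynomial `F(X u - x)` in one variable `X`. If `u` and `x` are the coordinates of the unit
and of an element `a` of an algebra, this is the value of `F` at `X - a`. -/
noncomputable def shift (φ : R →+* B) (F : MvPolynomial σ R) (u x : σ → B) : B[X] :=
  F.eval₂ (C.comp φ) (fun i => X * C (u i) - C (x i))

lemma shift_map {B' : Type*} [CommRing B'] (φ : R →+* B) (θ : B →+* B') (F : MvPolynomial σ R)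
    (u x : σ → B) :
    (shift φ F u x).map θ = shift (θ.comp φ) F (fun i => θ (u i)) (fun i => θ (x i)) := by
  rw [shift, shift, ← coe_mapRingHom, MvPolynomial.hom_eval₂]
  congr 1
  · ext; simp
  · ext; simp

lemma shift_map_coeff {R' : Type*} [CommRing R'] (ρ : R' →+* R) (φ : R →+* B)
    (F : MvPolynomial σ R') (u x : σ → B) :
    shift φ (MvPolynomial.map ρ F) u x = shift (φ.comp ρ) F u x := by
  rw [shift, shift, MvPolynomial.eval₂_map]
  rfl

lemma eval_zero_shift (φ : R →+* B) (F : MvPolynomial σ R) (u x : σ → B) :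
    (shift φ F u x).coeff 0 = F.eval₂ φ (fun i => - x i) := by
  rw [coeff_zero_eq_eval_zero, ← coe_evalRingHom, shift, MvPolynomial.hom_eval₂]
  congr 1
  · ext; simp
  · ext; simp

lemma natDegree_prod_linear (s : Finset σ) (p : σ → B[X]) (c : σ → B) (m : σ → ℕ)
    (hp : ∀ i, (p i).natDegree ≤ 1) (hc : ∀ i, (p i).coeff 1 = c i) :
    (∏ i ∈ s, p i ^ m i).natDegree ≤ ∑ i ∈ s, m i ∧
      (∏ i ∈ s, p i ^ m i).coeff (∑ i ∈ s, m i) = ∏ i ∈ s, c i ^ m i := by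
  classical
  induction s using Finset.induction with
  | empty => simp
  | insert a s ha ih =>
    have h1 : (p a ^ m a).natDegree ≤ m a := by
      simpa using natDegree_pow_le_of_le (m a) (hp a)
    have h2 : (p a ^ m a).coeff (m a) = c a ^ m a := by
      have := coeff_pow_of_natDegree_le (hp a) (m := m a)
      rw [mul_one] at this
      rw [this, hc]
    simp only [Finset.prod_insert ha, Finset.sum_insert ha]
    exact ⟨natDegree_mul_le_of_le h1 ih.1,
      by rw [coeff_mul_add_eq_of_natDegree_le h1 ih.1, h2, ih.2]⟩

/-- If `F` is homogeneous of degree `d`, then `F(X u - x)` has degree at most `d`, and its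
coefficient of `X ^ d` is `F(u)`. -/
lemma shift_natDegree_le_and_coeff {F : MvPolynomial σ R} {d : ℕ} (hF : F.IsHomogeneous d)
    (φ : R →+* B) (u x : σ → B) :
    (shift φ F u x).natDegree ≤ d ∧ (shift φ F u x).coeff d = F.eval₂ φ u := by
  have hlin : ∀ i, (X * C (u i) - C (x i) : B[X]).natDegree ≤ 1 := fun i => by compute_degree
  have hlc : ∀ i, (X * C (u i) - C (x i) : B[X]).coeff 1 = u i := fun i => by
    simp [coeff_C]
  have hm : ∀ m ∈ F.support, _ := fun m (hm : m ∈ F.support) =>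
    (hF.degree_eq_sum_deg_support hm).symm ▸ natDegree_prod_linear m.support _ u m hlin hlc
  rw [shift, MvPolynomial.eval₂_eq, MvPolynomial.eval₂_eq]
  constructor
  · refine natDegree_sum_le_of_forall_le _ _ fun m h => ?_
    exact (natDegree_C_mul_le _ _).trans (hm m h).1
  · rw [finsetSum_coeff]
    refine Finset.sum_congr rfl fun m h => ?_
    rw [RingHom.comp_apply, coeff_C_mul, (hm m h).2]

end Homogeneous

end GenericElement

/-! ### The generic determinant over a field -/

namespace GenericElement

open Polynomial

section Substitution

variable {ι D : Type*} [Fintype ι] [DecidableEq ι] [CommRing D] [IsDomain D]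
  {N : Matrix ι ι D} {P : D[X]}

/-- Let `P` be monic of least degree `d` annihilating `N`. A monic polynomial `p` of degree `d`
annihilating `a + b N`, where `a` and `b` are polynomials in a new variable, is obtained from `P`
by the corresponding affine substitution. -/
lemma comp_linear_eq_of_minimal (hP : P.Monic) (h0 : aeval N P = 0)
    (hmin : ∀ q : D[X], aeval N q = 0 → q.degree < P.degree → q = 0)
    {p : D[X][X]} (hpm : p.Monic) (hpd : p.natDegree = P.natDegree) {a b : D[X]} (hb : b ≠ 0)
    (hp : aeval (algebraMap _ (Matrix ι ι D[X]) a + b • N.map C) p = 0) :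
    p.comp (C a + C b * X) = C (b ^ P.natDegree) * P.map C := by
  set d := P.natDegree with hd
  have hl : (C a + C b * X).natDegree = 1 := by
    rw [add_comm]; exact natDegree_linear hb
  have hlc : (C a + C b * X).leadingCoeff = b := by
    rw [add_comm]; exact leadingCoeff_linear hb
  have hcd : (p.comp (C a + C b * X)).natDegree ≤ d :=
    natDegree_comp_le.trans (by rw [hpd, hl, mul_one])
  have hcc : (p.comp (C a + C b * X)).coeff d = b ^ d := by
    have := coeff_comp_degree_mul_degree (p := p) (q := C a + C b * X)
      (by rw [hl]; exact one_ne_zero)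
    rw [hl, mul_one, hpd, hpm.leadingCoeff, one_mul, hlc] at this
    exact this
  have hPd : (P.map (C : D →+* _)).natDegree = d := hP.natDegree_map _
  have hPc : (P.map (C : D →+* _)).coeff d = 1 := by
    rw [← hPd]; exact (hP.map _).coeff_natDegree
  rw [← sub_eq_zero]
  refine eq_zero_of_aeval_map_C_eq_zero N P.degree hmin _ ?_ ?_
  · have h1 : aeval (N.map C) (P.map (C : D →+* _)) = 0 := by
      rw [← map_aeval_matrix, h0]; ext; simp
    have h2 : aeval (N.map (C : D →+* _)) (C a + C b * X) =
        algebraMap _ (Matrix ι ι D[X]) a + b • N.map C := by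
      rw [map_add, map_mul, aeval_C, aeval_C, aeval_X, Algebra.smul_def]
    rw [map_sub, map_mul, h1, mul_zero, sub_zero, aeval_comp, h2]
    exact hp
  · rw [degree_eq_natDegree hP.ne_zero, degree_lt_iff_coeff_zero]
    intro k hk
    rw [coeff_sub, coeff_C_mul]
    rcases hk.eq_or_lt with rfl | hk
    · rw [hcc, hPc, mul_one, sub_self]
    · rw [coeff_eq_zero_of_natDegree_lt (hcd.trans_lt hk),
        coeff_eq_zero_of_natDegree_lt (hPd.trans_lt hk), mul_zero, sub_zero]

/-- The substitution `X N`: the constant coefficient is multiplied by `X ^ d`. -/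
lemma coeff_zero_of_minimal_smul (hP : P.Monic) (h0 : aeval N P = 0)
    (hmin : ∀ q : D[X], aeval N q = 0 → q.degree < P.degree → q = 0)
    {p : D[X][X]} (hpm : p.Monic) (hpd : p.natDegree = P.natDegree)
    (hp : aeval ((X : D[X]) • N.map C) p = 0) :
    p.coeff 0 = X ^ P.natDegree * C (P.coeff 0) := by
  have h := comp_linear_eq_of_minimal (a := 0) hP h0 hmin hpm hpd X_ne_zero
    (by rw [map_zero, zero_add]; exact hp)
  have h1 := congrArg (fun p => p.coeff 0) h
  simp only [coeff_zero_eq_eval_zero, eval_comp, eval_mul, eval_C, eval_add, eval_X, mul_zero,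
    add_zero] at h1
  rw [coeff_zero_eq_eval_zero, h1, ← coeff_zero_eq_eval_zero, coeff_map]

/-- The substitution `X - N`: the constant coefficient becomes `P` itself, up to sign. -/
lemma coeff_zero_of_minimal_sub (hP : P.Monic) (h0 : aeval N P = 0)
    (hmin : ∀ q : D[X], aeval N q = 0 → q.degree < P.degree → q = 0)
    {p : D[X][X]} (hpm : p.Monic) (hpd : p.natDegree = P.natDegree)
    (hp : aeval (algebraMap D[X] (Matrix ι ι D[X]) X - N.map C) p = 0) :
    (-1) ^ P.natDegree * p.coeff 0 = P := by
  have h := comp_linear_eq_of_minimal (a := X) (b := -1) hP h0 hmin hpm hpd (by simp)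
    (by rw [neg_smul, one_smul, ← sub_eq_add_neg]; exact hp)
  have h1 := congrArg (fun p => p.eval X) h
  simp only [eval_comp, eval_mul, eval_C, eval_add, eval_X, map_neg, map_one, neg_mul, one_mul,
    map_pow, eval_pow, eval_neg, eval_one, add_neg_cancel] at h1
  rw [coeff_zero_eq_eval_zero, h1, ← mul_assoc, ← mul_pow]
  simp only [mul_neg, mul_one, neg_neg, one_pow, one_mul]
  exact (eval_map C X).trans eval₂_C_X

end Substitution

section EvalAt

variable {σ ι R B : Type*} [Fintype σ] [CommRing R] [CommRing B]

lemma evalAt_mul_left (φ : R →+* B) (M : σ → Matrix ι ι R) (a : B) (x : σ → B) :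
    evalAt φ M (fun i => a * x i) = a • evalAt φ M x := by
  simp only [evalAt, Finset.smul_sum, smul_smul]

lemma evalAt_one [Fintype ι] [DecidableEq ι] (φ : R →+* B) {M : σ → Matrix ι ι R}
    {u : σ → R} (hu : ∑ i, u i • M i = 1) : evalAt φ M (fun i => φ (u i)) = 1 := by
  rw [← map_one φ.mapMatrix, ← hu, map_sum, evalAt]
  refine Finset.sum_congr rfl fun i _ => ?_
  ext
  simp

lemma evalAt_sub_of_one [Fintype ι] [DecidableEq ι] (φ : R →+* B) (M : σ → Matrix ι ι R)
    {u : σ → R} (hu : ∑ i, u i • M i = 1) (a : B) (x : σ → B) :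
    evalAt φ M (fun i => a * φ (u i) - x i) = algebraMap B _ a - evalAt φ M x := by
  have h1 := evalAt_one φ hu
  have h2 := evalAt_mul_left φ M a (fun i => φ (u i))
  rw [h1, ← Algebra.algebraMap_eq_smul_one] at h2
  rw [← h2]
  simp only [evalAt, sub_smul, Finset.sum_sub_distrib]

end EvalAt

section Field

variable {σ ι K : Type*} [Fintype σ] [Fintype ι] [DecidableEq ι] [Field K]

/-- The minimal polynomial of the generic linear combination of the matrices `M i`. -/
noncomputable def genericMinpoly (M : σ → Matrix ι ι K) : (MvPolynomial σ K)[X] :=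
  (exists_monic_minimal (generic M)).choose

lemma genericMinpoly_monic (M : σ → Matrix ι ι K) : (genericMinpoly M).Monic :=
  (exists_monic_minimal (generic M)).choose_spec.1

lemma aeval_genericMinpoly (M : σ → Matrix ι ι K) :
    aeval (generic M) (genericMinpoly M) = 0 :=
  (exists_monic_minimal (generic M)).choose_spec.2.1

lemma genericMinpoly_dvd_charpoly (M : σ → Matrix ι ι K) :
    genericMinpoly M ∣ (generic M).charpoly :=
  (exists_monic_minimal (generic M)).choose_spec.2.2.1

lemma eq_zero_of_degree_lt_genericMinpoly (M : σ → Matrix ι ι K) (q : (MvPolynomial σ K)[X])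
    (hq : aeval (generic M) q = 0) (hd : q.degree < (genericMinpoly M).degree) : q = 0 :=
  (exists_monic_minimal (generic M)).choose_spec.2.2.2 q hq hd

/-- The degree of the minimal polynomial of the generic linear combination. -/
noncomputable def genericDegree (M : σ → Matrix ι ι K) : ℕ := (genericMinpoly M).natDegree

/-- The generic determinant: up to the sign `(-1) ^ d`, the constant coefficient of the minimal
polynomial, of degree `d`, of the generic linear combination. -/
noncomputable def genericDet (M : σ → Matrix ι ι K) : MvPolynomial σ K :=
  (-1) ^ genericDegree M * (genericMinpoly M).coeff 0

lemma degree_genericMinpoly (M : σ → Matrix ι ι K) :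
    (genericMinpoly M).degree = genericDegree M :=
  degree_eq_natDegree (genericMinpoly_monic M).ne_zero

lemma eq_genericMinpoly (M : σ → Matrix ι ι K) (q : (MvPolynomial σ K)[X])
    (hq : aeval (generic M) q = 0) (hd : q.natDegree ≤ genericDegree M)
    (hc : q.coeff (genericDegree M) = 1) : q = genericMinpoly M := by
  rw [← sub_eq_zero]
  apply eq_zero_of_degree_lt_genericMinpoly M
  · rw [map_sub, hq, aeval_genericMinpoly, sub_zero]
  · rw [degree_genericMinpoly, degree_lt_iff_coeff_zero]
    intro k hk
    have hm : (genericMinpoly M).coeff (genericDegree M) = 1 :=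
      (genericMinpoly_monic M).coeff_natDegree
    rcases hk.eq_or_lt with rfl | hk
    · rw [coeff_sub, hc, hm, sub_self]
    · rw [coeff_sub, coeff_eq_zero_of_natDegree_lt (hd.trans_lt hk),
        coeff_eq_zero_of_natDegree_lt (p := genericMinpoly M) hk, sub_zero]

lemma genericDegree_le {M : σ → Matrix ι ι K} {q : (MvPolynomial σ K)[X]} (hm : q.Monic)
    (hq : aeval (generic M) q = 0) : genericDegree M ≤ q.natDegree := by
  by_contra! h
  refine hm.ne_zero (eq_zero_of_degree_lt_genericMinpoly M q hq ?_)
  rw [degree_genericMinpoly, degree_eq_natDegree hm.ne_zero]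
  exact_mod_cast h

/-- The minimal polynomial of the generic element specializes to a polynomial annihilating
any linear combination. -/
lemma aeval_evalAt_genericMinpoly {B : Type*} [CommRing B] (φ : K →+* B)
    (M : σ → Matrix ι ι K) (x : σ → B) :
    aeval (evalAt φ M x) ((genericMinpoly M).map (MvPolynomial.eval₂Hom φ x)) = 0 := by
  rw [← generic_map_eval₂Hom, ← map_aeval_matrix, aeval_genericMinpoly]
  ext; simp

lemma eval₂_genericDet {B : Type*} [CommRing B] (φ : K →+* B) (M : σ → Matrix ι ι K) (x : σ → B) :
    (genericDet M).eval₂ φ x = (-1) ^ genericDegree M *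
      ((genericMinpoly M).map (MvPolynomial.eval₂Hom φ x)).coeff 0 := by
  rw [genericDet, ← MvPolynomial.coe_eval₂Hom, map_mul, map_pow, map_neg, map_one, coeff_map]

lemma natDegree_map_genericMinpoly {B : Type*} [CommRing B] [Nontrivial B] (M : σ → Matrix ι ι K)
    (φ : MvPolynomial σ K →+* B) :
    ((genericMinpoly M).map φ).natDegree = (genericMinpoly M).natDegree :=
  (genericMinpoly_monic M).natDegree_map _

/-- Homogeneity comes from the substitution of `X ξ` for the generic element `ξ`. -/
lemma genericDet_isHomogeneous (M : σ → Matrix ι ι K) :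
    (genericDet M).IsHomogeneous (genericDegree M) := by
  apply isHomogeneous_of_eval₂_X_mul
  have h := coeff_zero_of_minimal_smul (genericMinpoly_monic M) (aeval_genericMinpoly M)
    (eq_zero_of_degree_lt_genericMinpoly M) ((genericMinpoly_monic M).map
      (MvPolynomial.eval₂Hom (C.comp MvPolynomial.C) (fun i => X * C (MvPolynomial.X i))))
    (natDegree_map_genericMinpoly M _) ?_
  · rw [eval₂_genericDet, h, genericDet, map_mul, map_pow, map_neg, map_one, genericDegree]
    exact mul_left_comm _ _ _
  · have := aeval_evalAt_genericMinpoly ((C : _ →+* (MvPolynomial σ K)[X]).comp MvPolynomial.C) M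
      (fun i => X * C (MvPolynomial.X i))
    rw [evalAt_mul_left] at this
    rw [generic, evalAt_map]
    exact this

variable (M : σ → Matrix ι ι K) {u : σ → K}

/-- With `ξ` the generic element, substituting `X - ξ` for `ξ` in the generic determinant gives the
minimal polynomial of `ξ`. -/
lemma shift_genericDet (hu : ∑ i, u i • M i = 1) :
    shift MvPolynomial.C (genericDet M) (fun i => MvPolynomial.C (u i)) MvPolynomial.X =
      genericMinpoly M := by
  have h := coeff_zero_of_minimal_sub (genericMinpoly_monic M) (aeval_genericMinpoly M)
    (eq_zero_of_degree_lt_genericMinpoly M) ((genericMinpoly_monic M).map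
      (MvPolynomial.eval₂Hom (C.comp MvPolynomial.C)
        (fun i => X * C (MvPolynomial.C (u i)) - C (MvPolynomial.X i))))
    (natDegree_map_genericMinpoly M _) ?_
  · rw [shift, eval₂_genericDet]
    exact h
  · have := aeval_evalAt_genericMinpoly ((C : _ →+* (MvPolynomial σ K)[X]).comp MvPolynomial.C) M
      (fun i => X * C (MvPolynomial.C (u i)) - C (MvPolynomial.X i))
    have h2 := evalAt_sub_of_one ((C : _ →+* (MvPolynomial σ K)[X]).comp MvPolynomial.C) M hu X
      (fun i => C (MvPolynomial.X i))
    rw [generic, evalAt_map]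
    rw [← h2]
    exact this

lemma eval_one_genericDet (hu : ∑ i, u i • M i = 1) :
    (genericDet M).eval₂ (RingHom.id K) u = 1 := by
  have h := (shift_natDegree_le_and_coeff (genericDet_isHomogeneous M) MvPolynomial.C
    (fun i => MvPolynomial.C (u i)) MvPolynomial.X).2
  rw [shift_genericDet M hu] at h
  have h1 : (genericMinpoly M).coeff (genericDegree M) = 1 :=
    (genericMinpoly_monic M).coeff_natDegree
  rw [h1] at h
  have h2 := MvPolynomial.hom_eval₂ (genericDet M) (RingHom.id K)
    (MvPolynomial.C : K →+* MvPolynomial σ K) u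
  rw [RingHom.comp_id, ← h] at h2
  exact MvPolynomial.C_injective σ K (h2.trans (map_one _).symm)

/-- The generic determinant is the only homogeneous polynomial `F` of degree `d` with value `1` at
the unit for which `F(X - ξ)` annihilates the generic element `ξ`. -/
lemma eq_genericDet (F : MvPolynomial σ K) (hF : F.IsHomogeneous (genericDegree M))
    (hF1 : F.eval₂ (RingHom.id K) u = 1)
    (h0 : aeval (generic M)
      (shift MvPolynomial.C F (fun i => MvPolynomial.C (u i)) MvPolynomial.X) = 0) :
    F = genericDet M := by
  have hs := shift_natDegree_le_and_coeff hF MvPolynomial.C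
    (fun i => MvPolynomial.C (u i)) MvPolynomial.X
  have hC : F.eval₂ MvPolynomial.C (fun i => MvPolynomial.C (u i)) =
      (1 : MvPolynomial σ K) := by
    have h2 := MvPolynomial.hom_eval₂ F (RingHom.id K) (MvPolynomial.C : K →+* MvPolynomial σ K) u
    rw [RingHom.comp_id, hF1, map_one] at h2
    exact h2.symm
  have h1 := eq_genericMinpoly M _ h0 hs.1 (hs.2.trans hC)
  have h2 := congrArg (fun p => p.coeff 0) h1
  simp only [eval_zero_shift] at h2
  have h3 := eval₂_mul_of_isHomogeneous hF MvPolynomial.C (-1) MvPolynomial.X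
  simp only [neg_mul, one_mul, MvPolynomial.eval₂_eta] at h3
  rw [genericDet, ← h2, h3, ← mul_assoc, ← mul_pow]
  simp

end Field

end GenericElement

/-! ### Multiplicativity of the generic determinant -/

namespace GenericElement

open Polynomial

section Multiplicative

variable {ι K R B : Type*} [Fintype ι] [CommRing R] [CommRing B]

/-- If the `M i` are the matrices of left multiplication by the elements of a basis, so that
`M i k j` is the `k`-th coordinate of the product of the `i`-th and the `j`-th one, linear
combinations of them multiply like the elements of the algebra. -/
lemma evalAt_mul (φ : R →+* B) {M : ι → Matrix ι ι R}
    (hmul : ∀ i j, M i * M j = ∑ k, M i k j • M k) (x y : ι → B) :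
    evalAt φ M x * evalAt φ M y = evalAt φ M ((evalAt φ M x).mulVec y) := by
  have h : ∀ i j, (M i).map φ * (M j).map φ = ∑ k, φ (M i k j) • (M k).map φ := by
    intro i j
    rw [← Matrix.map_mul, hmul]
    ext a b
    simp [Matrix.sum_apply]
  have h2 : ∀ k, (evalAt φ M x).mulVec y k = ∑ i, ∑ j, x i * φ (M i k j) * y j := by
    intro k
    simp only [evalAt, Matrix.mulVec, dotProduct, Matrix.sum_apply, Matrix.smul_apply,
      Matrix.map_apply, smul_eq_mul, Finset.sum_mul]
    exact Finset.sum_comm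
  have h3 : evalAt φ M ((evalAt φ M x).mulVec y) =
      ∑ k, ∑ i, ∑ j, (x i * φ (M i k j) * y j) • (M k).map φ := by
    refine Finset.sum_congr rfl fun k _ => ?_
    rw [h2]
    simp only [Finset.sum_smul]
  have h4 : evalAt φ M x * evalAt φ M y =
      ∑ i, ∑ j, ∑ k, (x i * φ (M i k j) * y j) • (M k).map φ := by
    simp only [evalAt, Finset.sum_mul_sum, Matrix.smul_mul, Matrix.mul_smul, h, Finset.smul_sum,
      smul_smul]
    refine Finset.sum_congr rfl fun i _ => Finset.sum_congr rfl fun j _ =>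
      Finset.sum_congr rfl fun k _ => ?_
    congr 1
    ring
  rw [h3, h4]
  simp_rw [Finset.sum_comm (s := Finset.univ (α := ι)) (t := Finset.univ (α := ι))
    (f := fun j k => (x _ * φ (M _ k j) * y j) • (M k).map φ)]
  rw [Finset.sum_comm]

lemma evalAt_mulVec_one [DecidableEq ι] (φ : R →+* B) {M : ι → Matrix ι ι R} {u : ι → R}
    (hru : ∀ i, (M i).mulVec u = Pi.single i 1) (x : ι → B) :
    (evalAt φ M x).mulVec (fun i => φ (u i)) = x := by
  have h : ∀ i, ((M i).map φ).mulVec (fun i => φ (u i)) = Pi.single i 1 := by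
    intro i
    have := RingHom.map_mulVec φ (M i) u
    ext k
    have h1 := this k
    rw [hru] at h1
    rw [show ((M i).map φ).mulVec (fun i => φ (u i)) k = ((M i).map φ).mulVec (φ ∘ u) k from rfl,
      ← h1]
    simp [Pi.single_apply, apply_ite φ]
  ext k
  simp only [evalAt, Matrix.sum_mulVec, Matrix.smul_mulVec, h, Finset.sum_apply, Pi.smul_apply,
    Pi.single_apply, smul_eq_mul, mul_ite, mul_one, mul_zero, Finset.sum_ite_eq, Finset.mem_univ,
    if_true]

/-- A divisor of a nonzero constant polynomial is constant. -/
lemma eq_C_of_dvd_C {σ : Type*} {D : Type*} [CommRing D] [IsDomain D] {g : MvPolynomial σ D}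
    {a : D} (ha : a ≠ 0) (h : g ∣ MvPolynomial.C a) : ∃ b, g = MvPolynomial.C b := by
  obtain ⟨k, hk⟩ := h
  have hne : g * k ≠ 0 := by
    rw [← hk]; exact (map_ne_zero_iff _ (MvPolynomial.C_injective σ D)).2 ha
  have := MvPolynomial.totalDegree_mul_of_isDomain (left_ne_zero_of_mul hne)
    (right_ne_zero_of_mul hne)
  rw [← hk, MvPolynomial.totalDegree_C] at this
  exact ⟨_, MvPolynomial.totalDegree_eq_zero_iff_eq_C.1 (by omega)⟩

/-- A divisor of a product `p(s) q(t)` of polynomials in disjoint sets of variables over a field is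
itself of this form, by unique factorization. -/
lemma exists_eq_mul_of_dvd_mul {σ τ : Type*} [Field K] [Finite σ] [Finite τ]
    {g : MvPolynomial τ (MvPolynomial σ K)}
    {p : MvPolynomial σ K} {q : MvPolynomial τ K} (hp : p ≠ 0) (hq : q ≠ 0)
    (h : g ∣ MvPolynomial.C p * MvPolynomial.map MvPolynomial.C q) :
    ∃ a b, g = MvPolynomial.C a * MvPolynomial.map MvPolynomial.C b := by
  obtain ⟨g₁, g₂, h₁, h₂, rfl⟩ := exists_dvd_and_dvd_of_dvd_mul h
  obtain ⟨a, rfl⟩ := eq_C_of_dvd_C hp h₁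
  have hs : ∀ q : MvPolynomial τ K, MvPolynomial.commAlgEquiv K τ σ
      (MvPolynomial.map MvPolynomial.C q) = MvPolynomial.C q := by
    intro q
    have : ((MvPolynomial.commAlgEquiv K τ σ).toRingEquiv.toRingHom.comp
        (MvPolynomial.map MvPolynomial.C)) = MvPolynomial.C := by
      apply MvPolynomial.ringHom_ext <;> simp
    exact congrArg (fun f : MvPolynomial τ K →+* _ => f q) this
  have h₃ := map_dvd (MvPolynomial.commAlgEquiv K τ σ) h₂
  rw [hs] at h₃
  obtain ⟨b, hb⟩ := eq_C_of_dvd_C hq h₃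
  rw [← hs, EmbeddingLike.apply_eq_iff_eq] at hb
  exact ⟨a, b, by rw [hb]⟩

lemma eval₂_evalAt_mulVec_map {B' : Type*} [CommRing B'] (φ : R →+* B) (θ : B →+* B')
    (M : ι → Matrix ι ι R) (F : MvPolynomial ι R) (x y : ι → B) :
    θ (F.eval₂ φ ((evalAt φ M x).mulVec y)) = F.eval₂ (θ.comp φ)
      ((evalAt (θ.comp φ) M (fun i => θ (x i))).mulVec (fun i => θ (y i))) := by
  rw [MvPolynomial.hom_eval₂]
  congr 1
  ext i
  rw [RingHom.map_mulVec, evalAt_map]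
  rfl

variable [DecidableEq ι] [Field K]

/-- The generic determinant divides the norm, since the minimal polynomial divides the
characteristic polynomial. -/
lemma genericDet_dvd_det (M : ι → Matrix ι ι K) : genericDet M ∣ (generic M).det := by
  obtain ⟨q, hq⟩ := genericMinpoly_dvd_charpoly M
  rw [Matrix.det_eq_sign_charpoly_coeff, hq, mul_coeff_zero, genericDet]
  have h1 : ∀ n : ℕ, IsUnit ((-1 : MvPolynomial ι K) ^ n) := fun n => (isUnit_one.neg).pow n
  rw [(h1 _).dvd_mul_left, (h1 _).mul_left_dvd]
  exact dvd_mul_right _ _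

lemma eval₂_det_generic (φ : R →+* B) (M : ι → Matrix ι ι R) (x : ι → B) :
    (generic M).det.eval₂ φ x = (evalAt φ M x).det := by
  rw [← generic_map_eval₂Hom, ← MvPolynomial.coe_eval₂Hom]
  exact (RingHom.map_det _ _)

lemma eval₂_mulVec_dvd (φ : R →+* B) {M : ι → Matrix ι ι R}
    (hmul : ∀ i j, M i * M j = ∑ k, M i k j • M k)
    {F : MvPolynomial ι R} (hF : F ∣ (generic M).det) (x y : ι → B) :
    F.eval₂ φ ((evalAt φ M x).mulVec y) ∣
      (generic M).det.eval₂ φ x * (generic M).det.eval₂ φ y := by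
  rw [eval₂_det_generic, eval₂_det_generic, ← Matrix.det_mul, evalAt_mul φ hmul,
    ← eval₂_det_generic]
  exact map_dvd (MvPolynomial.eval₂Hom φ _) hF

lemma eval₂_C_comp_C_X {σ τ : Type*} (N : MvPolynomial τ R) :
    N.eval₂ ((MvPolynomial.C : _ →+* MvPolynomial τ (MvPolynomial σ R)).comp MvPolynomial.C)
      MvPolynomial.X = MvPolynomial.map MvPolynomial.C N := by
  have : MvPolynomial.eval₂Hom ((MvPolynomial.C :
      _ →+* MvPolynomial τ (MvPolynomial σ R)).comp MvPolynomial.C) MvPolynomial.X =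
      MvPolynomial.map MvPolynomial.C := by
    apply MvPolynomial.ringHom_ext <;> simp
  exact congrArg (fun f : MvPolynomial τ R →+* _ => f N) this

lemma eval₂_C_comp_C_C_X {σ τ : Type*} (N : MvPolynomial σ R) :
    N.eval₂ ((MvPolynomial.C : _ →+* MvPolynomial τ (MvPolynomial σ R)).comp MvPolynomial.C)
      (fun i => MvPolynomial.C (MvPolynomial.X i)) = MvPolynomial.C N := by
  have : MvPolynomial.eval₂Hom ((MvPolynomial.C :
      _ →+* MvPolynomial τ (MvPolynomial σ R)).comp MvPolynomial.C)
      (fun i => MvPolynomial.C (MvPolynomial.X i)) = MvPolynomial.C := by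
    apply MvPolynomial.ringHom_ext <;> simp
  exact congrArg (fun f : MvPolynomial σ R →+* _ => f N) this

lemma det_generic_ne_zero {M : ι → Matrix ι ι K} {u : ι → K} (hu : ∑ i, u i • M i = 1) :
    (generic M).det ≠ 0 := by
  intro h
  have h1 : (generic M).det.eval₂ (RingHom.id K) u = 1 := by
    rw [eval₂_det_generic]
    have := evalAt_one (RingHom.id K) hu
    simp only [RingHom.id_apply] at this
    rw [this, Matrix.det_one]
  rw [h, MvPolynomial.eval₂_zero] at h1
  exact zero_ne_one h1

/-- If `F` divides the norm `N`, then `F(st)` divides `N(st) = N(s) N(t)`, hence splits as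
`a(s) b(t)`. -/
lemma exists_factor_eval₂_mulVec {M : ι → Matrix ι ι K} {u : ι → K}
    (hmul : ∀ i j, M i * M j = ∑ k, M i k j • M k) (hu : ∑ i, u i • M i = 1)
    {F : MvPolynomial ι K} (hF : F ∣ (generic M).det) :
    ∃ a b, F.eval₂
      ((MvPolynomial.C : _ →+* MvPolynomial ι (MvPolynomial ι K)).comp MvPolynomial.C)
      ((evalAt (MvPolynomial.C.comp MvPolynomial.C) M
        (fun i => MvPolynomial.C (MvPolynomial.X i))).mulVec MvPolynomial.X) =
    MvPolynomial.C a * MvPolynomial.map MvPolynomial.C b := by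
  have h1 := eval₂_mulVec_dvd ((MvPolynomial.C : _ →+* MvPolynomial ι (MvPolynomial ι K)).comp
    MvPolynomial.C) hmul hF (fun i => MvPolynomial.C (MvPolynomial.X i)) MvPolynomial.X
  rw [eval₂_C_comp_C_C_X, eval₂_C_comp_C_X] at h1
  exact exists_eq_mul_of_dvd_mul (det_generic_ne_zero hu) (det_generic_ne_zero hu) h1

/-- Every divisor of the norm with value `1` at the unit is multiplicative: by unique
factorization `F(st)` is a product `a(s) b(t)`, and putting `s = 1` or `t = 1` identifies the
factors. -/
lemma eval₂_mulVec_of_dvd_det {M : ι → Matrix ι ι K} {u : ι → K}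
    (hmul : ∀ i j, M i * M j = ∑ k, M i k j • M k) (hu : ∑ i, u i • M i = 1)
    (hru : ∀ i, (M i).mulVec u = Pi.single i 1)
    {F : MvPolynomial ι K} (hF : F ∣ (generic M).det) (hF1 : F.eval₂ (RingHom.id K) u = 1) :
    F.eval₂
      ((MvPolynomial.C : _ →+* MvPolynomial ι (MvPolynomial ι K)).comp MvPolynomial.C)
      ((evalAt (MvPolynomial.C.comp MvPolynomial.C) M
        (fun i => MvPolynomial.C (MvPolynomial.X i))).mulVec MvPolynomial.X) =
    MvPolynomial.C F * MvPolynomial.map MvPolynomial.C F := by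
  obtain ⟨a, b, hab⟩ := exists_factor_eval₂_mulVec hmul hu hF
  set α := a.eval₂ (RingHom.id K) u with hα
  set β := b.eval₂ (RingHom.id K) u with hβ
  have h1 : F = a * MvPolynomial.C β := by
    set θ : MvPolynomial ι (MvPolynomial ι K) →+* MvPolynomial ι K :=
      MvPolynomial.eval₂Hom (RingHom.id (MvPolynomial ι K)) (fun i => MvPolynomial.C (u i)) with hθ
    have e1 : θ.comp (MvPolynomial.C.comp MvPolynomial.C) = MvPolynomial.C := by ext; simp [θ]
    have e2 : ∀ p, θ (MvPolynomial.C p) = p := fun p => by simp [θ]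
    have e3 : ∀ i, θ (MvPolynomial.X i) = MvPolynomial.C (u i) := fun p => by simp [θ]
    have e4 : θ (MvPolynomial.map MvPolynomial.C b) = MvPolynomial.C β := by
      rw [hθ, MvPolynomial.coe_eval₂Hom, MvPolynomial.eval₂_map, hβ, MvPolynomial.hom_eval₂]
      rfl
    have h := congrArg θ hab
    rw [eval₂_evalAt_mulVec_map, map_mul, e1, e2, e4] at h
    simp only [e2, e3] at h
    rw [evalAt_mulVec_one _ hru, MvPolynomial.eval₂_eta] at h
    exact h
  have h2 : F = MvPolynomial.C α * b := by
    set θ : MvPolynomial ι (MvPolynomial ι K) →+* MvPolynomial ι K :=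
      MvPolynomial.eval₂Hom (MvPolynomial.eval₂Hom MvPolynomial.C
        (fun i => MvPolynomial.C (u i))) MvPolynomial.X with hθ
    have e1 : θ.comp (MvPolynomial.C.comp MvPolynomial.C) = MvPolynomial.C := by ext; simp [θ]
    have e2 : ∀ i, θ (MvPolynomial.C (MvPolynomial.X i)) = MvPolynomial.C (u i) :=
      fun p => by simp [θ]
    have e3 : ∀ i, θ (MvPolynomial.X i) = MvPolynomial.X i := fun p => by simp [θ]
    have e4 : θ (MvPolynomial.map MvPolynomial.C b) = b := by
      rw [hθ, MvPolynomial.coe_eval₂Hom, MvPolynomial.eval₂_map]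
      convert MvPolynomial.eval₂_eta b
      ext; simp
    have e5 : θ (MvPolynomial.C a) = MvPolynomial.C α := by
      rw [hθ, MvPolynomial.coe_eval₂Hom, MvPolynomial.eval₂_C, hα, MvPolynomial.hom_eval₂]
      rfl
    have h := congrArg θ hab
    rw [eval₂_evalAt_mulVec_map, map_mul, e1, e4, e5] at h
    simp only [e2, e3] at h
    rw [evalAt_one _ hu, Matrix.one_mulVec, MvPolynomial.eval₂_eta] at h
    exact h
  have h3 : α * β = 1 := by
    have := congrArg (MvPolynomial.eval₂ (RingHom.id K) u) h1
    rw [hF1, MvPolynomial.eval₂_mul, MvPolynomial.eval₂_C] at this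
    exact this.symm
  have h4 : (MvPolynomial.C (MvPolynomial.C α) : MvPolynomial ι (MvPolynomial ι K)) *
      MvPolynomial.C (MvPolynomial.C β) = 1 := by
    rw [← map_mul, ← map_mul, h3, map_one, map_one]
  have h5 : MvPolynomial.C F = MvPolynomial.C a *
      (MvPolynomial.C (MvPolynomial.C β) : MvPolynomial ι (MvPolynomial ι K)) := by
    conv_lhs => rw [h1, map_mul]
  have h6 : MvPolynomial.map MvPolynomial.C F =
      (MvPolynomial.C (MvPolynomial.C α) : MvPolynomial ι (MvPolynomial ι K)) *
        MvPolynomial.map MvPolynomial.C b := by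
    conv_lhs => rw [h2, map_mul, MvPolynomial.map_C]
  rw [hab, h5, h6, mul_assoc, ← mul_assoc (MvPolynomial.C (MvPolynomial.C β)),
    mul_comm (MvPolynomial.C (MvPolynomial.C β)), h4, one_mul]

end Multiplicative

end GenericElement

/-! ### Change of basis -/

namespace GenericElement

open Polynomial

section ChangeOfBasis

variable {σ τ ι κ R B K : Type*} [Fintype σ] [Fintype τ] [Fintype ι] [Fintype κ]
  [CommRing R] [CommRing B] [Field K]

/-- In all lemmas on intertwining, `S` is the matrix of a change of coordinates of the element, and
`T` the matrix of a change of coordinates of the space on which the matrices act. -/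
lemma mul_evalAt_of_intertwine (φ : R →+* B) {S : Matrix τ σ R} {T : Matrix κ ι R}
    {M : σ → Matrix ι ι R} {M' : τ → Matrix κ κ R}
    (h : ∀ i, T * M i = (∑ k, S k i • M' k) * T) (x : σ → B) :
    T.map φ * evalAt φ M x = evalAt φ M' ((S.map φ).mulVec x) * T.map φ := by
  have h1 : ∀ i, T.map φ * (M i).map φ = ∑ k, φ (S k i) • ((M' k).map φ * T.map φ) := by
    intro i
    rw [← Matrix.map_mul, h]
    ext a b
    simp [Matrix.mul_apply, Matrix.sum_apply, Finset.sum_mul, Finset.mul_sum]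
    rw [Finset.sum_comm]
    simp only [mul_assoc]
  simp only [evalAt, Matrix.mul_sum, Matrix.mul_smul, h1, Matrix.sum_mul, Matrix.smul_mul,
    Matrix.mulVec, dotProduct, Finset.sum_smul, Finset.smul_sum, smul_smul, Matrix.map_apply]
  rw [Finset.sum_comm]
  simp only [mul_comm]

variable [DecidableEq ι] [DecidableEq κ]

lemma mul_aeval_of_intertwine {S : Matrix κ ι B} {N : Matrix ι ι B} {N' : Matrix κ κ B}
    (h : S * N = N' * S) (p : B[X]) : S * aeval N p = aeval N' p * S := by
  induction p using Polynomial.induction_on' with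
  | add p q hp hq => rw [map_add, map_add, Matrix.mul_add, Matrix.add_mul, hp, hq]
  | monomial n a =>
    have hn : S * N ^ n = N' ^ n * S := by
      induction n with
      | zero => simp
      | succ n ih => rw [pow_succ, ← Matrix.mul_assoc, ih, Matrix.mul_assoc, h, ← Matrix.mul_assoc,
          pow_succ]
    rw [aeval_monomial, aeval_monomial, ← Algebra.smul_def, ← Algebra.smul_def, Matrix.mul_smul,
      Matrix.smul_mul, hn]

lemma aeval_evalAt_eq_zero_of_intertwine (φ : R →+* B) {S : Matrix τ σ R}
    {T : Matrix κ ι R} {T' : Matrix ι κ R} (hT : T' * T = 1)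
    {M : σ → Matrix ι ι R} {M' : τ → Matrix κ κ R}
    (h : ∀ i, T * M i = (∑ k, S k i • M' k) * T) (x : σ → B) (p : B[X])
    (hp : aeval (evalAt φ M' ((S.map φ).mulVec x)) p = 0) : aeval (evalAt φ M x) p = 0 := by
  have h1 := mul_aeval_of_intertwine (mul_evalAt_of_intertwine φ h x) p
  rw [hp, Matrix.zero_mul] at h1
  have h2 : T'.map φ * T.map φ = 1 := by
    rw [← Matrix.map_mul, hT, Matrix.map_one _ (map_zero φ) (map_one φ)]
  rw [← Matrix.one_mul (aeval (evalAt φ M x) p), ← h2, Matrix.mul_assoc, h1, Matrix.mul_zero]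

variable {S : Matrix τ σ K} {S' : Matrix σ τ K} {T : Matrix κ ι K} {T' : Matrix ι κ K}
  {M : σ → Matrix ι ι K} {M' : τ → Matrix κ κ K}

lemma aeval_generic_map_genericMinpoly (hT : T' * T = 1)
    (h : ∀ i, T * M i = (∑ k, S k i • M' k) * T) :
    aeval (generic M) ((genericMinpoly M').map (MvPolynomial.eval₂Hom MvPolynomial.C
      ((S.map MvPolynomial.C).mulVec MvPolynomial.X))) = 0 :=
  aeval_evalAt_eq_zero_of_intertwine MvPolynomial.C hT h _ _
    (aeval_evalAt_genericMinpoly MvPolynomial.C M' _)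

lemma genericDegree_le_of_intertwine (hT : T' * T = 1)
    (h : ∀ i, T * M i = (∑ k, S k i • M' k) * T) : genericDegree M ≤ genericDegree M' := by
  refine (genericDegree_le ((genericMinpoly_monic M').map _)
    (aeval_generic_map_genericMinpoly hT h)).trans ?_
  exact natDegree_map_le

/-- The generic degree does not depend on the basis. -/
lemma genericDegree_eq_of_intertwine (hT : T' * T = 1) (hT' : T * T' = 1)
    (h : ∀ i, T * M i = (∑ k, S k i • M' k) * T)
    (h' : ∀ k, T' * M' k = (∑ i, S' i k • M i) * T') : genericDegree M = genericDegree M' :=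
  (genericDegree_le_of_intertwine hT h).antisymm (genericDegree_le_of_intertwine hT' h')

/-- The generic determinant does not depend on the basis, up to the linear change of coordinates. -/
lemma genericDet_eval₂_of_intertwine (hT : T' * T = 1) (hT' : T * T' = 1)
    (h : ∀ i, T * M i = (∑ k, S k i • M' k) * T)
    (h' : ∀ k, T' * M' k = (∑ i, S' i k • M i) * T') :
    (genericDet M').eval₂ MvPolynomial.C ((S.map MvPolynomial.C).mulVec MvPolynomial.X) =
      genericDet M := by
  have hd := genericDegree_eq_of_intertwine hT hT' h h'
  have h1 := eq_genericMinpoly M _ (aeval_generic_map_genericMinpoly hT h)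
    (by rw [hd]; exact natDegree_map_le)
    (by
      rw [hd, coeff_map]
      have : (genericMinpoly M').coeff (genericDegree M') = 1 :=
        (genericMinpoly_monic M').coeff_natDegree
      rw [this, map_one])
  rw [eval₂_genericDet, h1, genericDet, hd]

end ChangeOfBasis

lemma shift_map_generic {ι R K : Type*} [CommRing R] [CommRing K] (ρ : R →+* K)
    (F : MvPolynomial ι R) (u : ι → R) :
    (shift MvPolynomial.C F (fun i => MvPolynomial.C (u i)) MvPolynomial.X).map
      (MvPolynomial.map ρ) = shift MvPolynomial.C (MvPolynomial.map ρ F)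
        (fun i => MvPolynomial.C (ρ (u i))) MvPolynomial.X := by
  rw [shift_map, shift_map_coeff]
  congr 1
  · ext1; simp
  · ext1; simp
  · ext1; simp

lemma map_intertwine {ι κ K Q : Type*} [Fintype ι] [Fintype κ] [CommRing K] [CommRing Q]
    (ρ : Q →+* K) {S : Matrix κ ι Q} {M : ι → Matrix ι ι Q} {M' : κ → Matrix κ κ Q}
    (h : ∀ i, S * M i = (∑ k, S k i • M' k) * S) (i : ι) :
    S.map ρ * (M i).map ρ = (∑ k, S.map ρ k i • (M' k).map ρ) * S.map ρ := by
  rw [← Matrix.map_mul, h, Matrix.map_mul]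
  congr 1
  ext1 a b
  simp [Matrix.sum_apply]

/-! ### Integrality of the generic determinant -/

section Descent

variable {ι R B K : Type*} [Fintype ι] [DecidableEq ι] [CommRing R] [CommRing B] [Field K]

attribute [local instance] MvPolynomial.algebraMvPolynomial in
/-- Over an integrally closed domain, the generic determinant has integral coefficients: it is
a coefficient of a monic divisor of the characteristic polynomial of the generic element. -/
lemma exists_map_eq_genericDet {σ : Type*} [Fintype σ] [IsDomain R] [IsIntegrallyClosed R]
    [Algebra R K] [IsFractionRing R K] (M : σ → Matrix ι ι R) :
    ∃ F : MvPolynomial σ R, MvPolynomial.map (algebraMap R K) F =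
      genericDet (fun i => (M i).map (algebraMap R K)) := by
  have hdvd := genericMinpoly_dvd_charpoly (fun i => (M i).map (algebraMap R K))
  rw [← generic_map_map] at hdvd
  have hm : (generic M).map (MvPolynomial.map (algebraMap R K)) =
    (algebraMap (MvPolynomial σ R) (MvPolynomial σ K)).mapMatrix (generic M) := rfl
  rw [hm, RingHom.mapMatrix_apply, Matrix.charpoly_map] at hdvd
  have hint := isIntegral_coeff_of_dvd _ _ (Matrix.charpoly_monic _) (genericMinpoly_monic _) hdvd 0
  have hint' : IsIntegral (MvPolynomial σ R)
      (genericDet (fun i => (M i).map (algebraMap R K))) :=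
    ((isIntegral_one.neg).pow _).mul hint
  rw [MvPolynomial.isIntegral_iff_isIntegral_coeff] at hint'
  refine (MvPolynomial.mem_range_map_iff_coeffs_subset (f := algebraMap R K)).2 ?_
  intro c hc
  obtain ⟨m, -, rfl⟩ := MvPolynomial.mem_coeffs_iff.1 hc
  exact IsIntegrallyClosed.isIntegral_iff.1 (hint' m)

/-- `F` is the generic determinant of the family `M` of matrices over `R`, computed over a field `K`
containing `R` (via `ρ`). -/
structure IsGenericDet (ρ : R →+* K) (M : ι → Matrix ι ι R) (F : MvPolynomial ι R) : Prop where
  injective : Function.Injective ρ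
  map_eq : MvPolynomial.map ρ F = genericDet (fun i => (M i).map ρ)

namespace IsGenericDet

variable {ρ : R →+* K} {M : ι → Matrix ι ι R} {F : MvPolynomial ι R} {u : ι → R}

lemma isHomogeneous (h : IsGenericDet ρ M F) :
    F.IsHomogeneous (genericDegree (fun i => (M i).map ρ)) := by
  apply MvPolynomial.IsHomogeneous.of_map h.injective
  rw [h.map_eq]
  exact genericDet_isHomogeneous _

lemma sum_map_eq_one (ρ : R →+* K) (hu : ∑ i, u i • M i = 1) :
    ∑ i, ρ (u i) • (M i).map ρ = 1 := evalAt_one ρ hu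

lemma eval₂_one (h : IsGenericDet ρ M F) (hu : ∑ i, u i • M i = 1) (φ : R →+* B) :
    F.eval₂ φ (fun i => φ (u i)) = 1 := by
  have h1 : F.eval₂ (RingHom.id R) u = 1 := by
    apply h.injective
    have h2 := eval_one_genericDet _ (sum_map_eq_one ρ hu)
    rw [← h.map_eq, MvPolynomial.eval₂_map] at h2
    rw [MvPolynomial.hom_eval₂, map_one]
    exact h2
  have h3 := MvPolynomial.hom_eval₂ F (RingHom.id R) φ u
  rw [h1, map_one] at h3
  exact h3.symm

lemma shift_coeff (h : IsGenericDet ρ M F) (hu : ∑ i, u i • M i = 1) (φ : R →+* B) (x : ι → B) :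
    (shift φ F (fun i => φ (u i)) x).coeff (genericDegree (fun i => (M i).map ρ)) = 1 := by
  rw [(shift_natDegree_le_and_coeff h.isHomogeneous φ _ x).2, h.eval₂_one hu]

lemma map_generic_eq_zero (ρ : R →+* K) (hρ : Function.Injective ρ)
    {p : (MvPolynomial ι R)[X]} : aeval (generic M) p = 0 ↔
    aeval (generic (fun i => (M i).map ρ)) (p.map (MvPolynomial.map ρ)) = 0 := by
  have hi : Function.Injective (MvPolynomial.map (σ := ι) ρ) := MvPolynomial.map_injective ρ hρ
  rw [← generic_map_map, ← map_aeval_matrix]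
  constructor
  · intro h
    rw [h]; ext1; simp
  · intro h
    ext1 a b
    apply hi
    have := congrFun (congrFun h a) b
    rw [Matrix.zero_apply, map_zero]
    exact this

/-- The generic Cayley–Hamilton identity, specialized. -/
lemma aeval_shift (h : IsGenericDet ρ M F) (hu : ∑ i, u i • M i = 1) (φ : R →+* B) (x : ι → B) :
    aeval (evalAt φ M x) (shift φ F (fun i => φ (u i)) x) = 0 := by
  have h1 : aeval (generic M)
      (shift MvPolynomial.C F (fun i => MvPolynomial.C (u i)) MvPolynomial.X) = 0 := by
    rw [map_generic_eq_zero ρ h.injective, shift_map_generic, h.map_eq,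
      shift_genericDet _ (sum_map_eq_one ρ hu), aeval_genericMinpoly]
  have h2 := map_aeval_matrix (MvPolynomial.eval₂Hom φ x) (generic M)
    (shift MvPolynomial.C F (fun i => MvPolynomial.C (u i)) MvPolynomial.X)
  rw [h1, generic_map_eval₂Hom, shift_map] at h2
  have h3 : (MvPolynomial.eval₂Hom φ x).comp MvPolynomial.C = φ := by ext1; simp
  simp only [h3, MvPolynomial.coe_eval₂Hom, MvPolynomial.eval₂_C, MvPolynomial.eval₂_X] at h2
  rw [← h2]
  ext1; simp

/-- The generic determinant is multiplicative. The universal identity holds over the field, hence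
over `R` because `ρ` is injective, and then specializes to every `R`-algebra `B`. -/
lemma eval₂_mul (h : IsGenericDet ρ M F) (hu : ∑ i, u i • M i = 1)
    (hmul : ∀ i j, M i * M j = ∑ k, M i k j • M k)
    (hru : ∀ i, (M i).mulVec u = Pi.single i 1) (φ : R →+* B) (x y : ι → B) :
    F.eval₂ φ ((evalAt φ M x).mulVec y) = F.eval₂ φ x * F.eval₂ φ y := by
  have hmul' : ∀ i j, (M i).map ρ * (M j).map ρ = ∑ k, (M i).map ρ k j • (M k).map ρ := by
    intro i j
    rw [← Matrix.map_mul, hmul]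
    ext1 a b
    simp [Matrix.sum_apply]
  have hru' : ∀ i, ((M i).map ρ).mulVec (fun i => ρ (u i)) = Pi.single i 1 := by
    intro i
    ext1 k
    have h1 := RingHom.map_mulVec ρ (M i) u k
    rw [hru] at h1
    rw [show ((M i).map ρ).mulVec (fun i => ρ (u i)) k = ((M i).map ρ).mulVec (ρ ∘ u) k from rfl,
      ← h1]
    simp [Pi.single_apply, apply_ite ρ]
  have hK := eval₂_mulVec_of_dvd_det hmul' (sum_map_eq_one ρ hu) hru' (genericDet_dvd_det _)
    (eval_one_genericDet _ (sum_map_eq_one ρ hu))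
  have hR : F.eval₂
      ((MvPolynomial.C : _ →+* MvPolynomial ι (MvPolynomial ι R)).comp MvPolynomial.C)
      ((evalAt (MvPolynomial.C.comp MvPolynomial.C) M
        (fun i => MvPolynomial.C (MvPolynomial.X i))).mulVec MvPolynomial.X) =
      MvPolynomial.C F * MvPolynomial.map MvPolynomial.C F := by
    have hi : Function.Injective (MvPolynomial.map (σ := ι) (MvPolynomial.map (σ := ι) ρ)) :=
      MvPolynomial.map_injective _ (MvPolynomial.map_injective ρ h.injective)
    apply hi
    rw [← h.map_eq, MvPolynomial.eval₂_map, evalAt_map_family] at hK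
    rw [eval₂_evalAt_mulVec_map, map_mul, MvPolynomial.map_C, MvPolynomial.map_map]
    rw [MvPolynomial.map_map] at hK
    have e1 : (MvPolynomial.map (σ := ι) (MvPolynomial.map (σ := ι) ρ)).comp
        (MvPolynomial.C.comp MvPolynomial.C) =
        ((MvPolynomial.C : _ →+* MvPolynomial ι (MvPolynomial ι K)).comp
          MvPolynomial.C).comp ρ := by
      ext1; simp
    have e2 : (MvPolynomial.map (σ := ι) ρ).comp MvPolynomial.C = MvPolynomial.C.comp ρ := by
      ext1; simp
    rw [e1, e2]
    simp only [MvPolynomial.map_C, MvPolynomial.map_X]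
    exact hK
  set θ : MvPolynomial ι (MvPolynomial ι R) →+* B :=
    MvPolynomial.eval₂Hom (MvPolynomial.eval₂Hom φ x) y with hθ
  have e1 : θ.comp (MvPolynomial.C.comp MvPolynomial.C) = φ := by ext1; simp [θ]
  have e2 : ∀ i, θ (MvPolynomial.C (MvPolynomial.X i)) = x i := fun i => by simp [θ]
  have e3 : ∀ i, θ (MvPolynomial.X i) = y i := fun i => by simp [θ]
  have e4 : θ (MvPolynomial.C F) = F.eval₂ φ x := by simp [θ]
  have e5 : θ (MvPolynomial.map MvPolynomial.C F) = F.eval₂ φ y := by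
    rw [hθ, MvPolynomial.coe_eval₂Hom, MvPolynomial.eval₂_map]
    congr 1
    ext1; simp
  have := congrArg θ hR
  rw [eval₂_evalAt_mulVec_map, map_mul, e1, e4, e5] at this
  simp only [e2, e3] at this
  exact this

/-- The generic determinant is determined by its characterizing properties at the generic point. -/
lemma eq_of_aeval_shift (h : IsGenericDet ρ M F)
    {F' : MvPolynomial ι R} (hF' : F'.IsHomogeneous (genericDegree (fun i => (M i).map ρ)))
    (h1 : F'.eval₂ (RingHom.id R) u = 1)
    (h0 : aeval (generic M)
      (shift MvPolynomial.C F' (fun i => MvPolynomial.C (u i)) MvPolynomial.X) = 0) :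
    F' = F := by
  apply MvPolynomial.map_injective ρ h.injective
  rw [h.map_eq]
  refine eq_genericDet _ _ (hF'.map ρ) (u := fun i => ρ (u i)) ?_ ?_
  · rw [MvPolynomial.eval₂_map]
    have := MvPolynomial.hom_eval₂ F' (RingHom.id R) ρ u
    rw [h1, map_one] at this
    exact this.symm
  · rw [← shift_map_generic, ← map_generic_eq_zero ρ h.injective]
    exact h0

/-- The generic element satisfies no nonzero polynomial of degree less than the generic degree, also
if the coefficients are not in a field. -/
lemma eq_zero_of_degree_lt (hρ : Function.Injective ρ) (q : (MvPolynomial ι R)[X])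
    (hq : aeval (generic M) q = 0) (hd : q.degree < genericDegree (fun i => (M i).map ρ)) :
    q = 0 := by
  have hi : Function.Injective (MvPolynomial.map (σ := ι) ρ) := MvPolynomial.map_injective ρ hρ
  rw [← Polynomial.map_eq_zero_iff hi]
  refine eq_zero_of_degree_lt_genericMinpoly _ _ ((map_generic_eq_zero ρ hρ).1 hq) ?_
  rw [degree_genericMinpoly]
  exact degree_map_le.trans_lt hd

end IsGenericDet

/-- The generic determinants in two bases agree: `F'` at the new coordinates is `F` at the old
ones. Here `S` is the matrix of the change of coordinates. -/
lemma eval₂_eq_of_intertwine {κ Q : Type*} [Fintype κ] [DecidableEq κ] [CommRing Q]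
    {ρ : Q →+* K} {S : Matrix κ ι Q} {S' : Matrix ι κ Q} {M : ι → Matrix ι ι Q}
    {M' : κ → Matrix κ κ Q} {F : MvPolynomial ι Q} {F' : MvPolynomial κ Q}
    (hF : IsGenericDet ρ M F) (hF' : IsGenericDet ρ M' F')
    (hS : S' * S = 1) (hS' : S * S' = 1)
    (h : ∀ i, S * M i = (∑ k, S k i • M' k) * S)
    (h' : ∀ k, S' * M' k = (∑ i, S' i k • M i) * S') :
    genericDegree (fun i => (M i).map ρ) = genericDegree (fun i => (M' i).map ρ) ∧
    ∀ (φ : Q →+* B) (x : ι → B), F'.eval₂ φ ((S.map φ).mulVec x) = F.eval₂ φ x := by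
  have h1 : S'.map ρ * S.map ρ = 1 := by
    rw [← Matrix.map_mul, hS, Matrix.map_one _ (map_zero ρ) (map_one ρ)]
  have h2 : S.map ρ * S'.map ρ = 1 := by
    rw [← Matrix.map_mul, hS', Matrix.map_one _ (map_zero ρ) (map_one ρ)]
  refine ⟨genericDegree_eq_of_intertwine h1 h2 (map_intertwine ρ h)
    (map_intertwine ρ h'), fun φ x => ?_⟩
  have h3 := genericDet_eval₂_of_intertwine h1 h2 (map_intertwine ρ h) (map_intertwine ρ h')
  have h4 : F'.eval₂ MvPolynomial.C ((S.map MvPolynomial.C).mulVec MvPolynomial.X) = F := by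
    apply MvPolynomial.map_injective ρ hF.injective
    rw [hF.map_eq, ← h3, ← hF'.map_eq, MvPolynomial.eval₂_map, MvPolynomial.hom_eval₂]
    congr 1
    · ext1; simp
    · ext1 k
      simp [Matrix.mulVec, dotProduct]
  conv_rhs => rw [← h4, ← MvPolynomial.coe_eval₂Hom, MvPolynomial.hom_eval₂]
  congr 1
  · ext1; simp
  · ext1 k
    simp [Matrix.mulVec, dotProduct]

end Descent

end GenericElement

/-! ### Exterior powers -/

namespace exteriorPower

open Polynomial

/-- The powers `1, a, …, a ^ d` of an element annihilated by a monic polynomial of degree `d` have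
vanishing exterior product. -/
lemma ιMulti_pow_eq_zero {R M : Type*} [CommRing R] [Ring M] [Algebra R M] (a : M)
    (p : R[X]) (d : ℕ) (hc : p.coeff d = 1) (hd : p.natDegree ≤ d) (h : aeval a p = 0) :
    ιMulti R (d + 1) (fun i : Fin (d + 1) => a ^ (i : ℕ)) = 0 := by
  have h1 : a ^ d = ∑ i : Fin d, (- p.coeff i) • a ^ (i : ℕ) := by
    rw [aeval_eq_sum_range' (Nat.lt_succ_of_le hd), Finset.sum_range_succ, hc, one_smul] at h
    rw [eq_neg_of_add_eq_zero_right h, Finset.sum_range]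
    simp
  have h2 : (fun i : Fin (d + 1) => a ^ (i : ℕ)) =
      Function.update (fun i : Fin (d + 1) => a ^ (i : ℕ)) (Fin.last d) (a ^ d) := by
    ext i
    rcases eq_or_ne i (Fin.last d) with rfl | hi
    · simp
    · simp [hi]
  rw [h2, h1, AlternatingMap.map_update_sum]
  refine Finset.sum_eq_zero fun i _ => ?_
  rw [AlternatingMap.map_update_smul]
  have h3 : (a ^ (i : ℕ) : M) = (fun i : Fin (d + 1) => a ^ (i : ℕ)) i.castSucc := rfl
  rw [h3, AlternatingMap.map_update_self _ _ (Fin.castSucc_lt_last i).ne', smul_zero]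

/-- Linearly independent vectors in a finite free module over a domain have nonzero exterior
product. -/
lemma ιMulti_ne_zero {R M ι : Type*} [CommRing R] [IsDomain R] [AddCommGroup M] [Module R M]
    [Finite ι] (b : Module.Basis ι R M) {k : ℕ} {v : Fin k → M} (hv : LinearIndependent R v) :
    ιMulti R k v ≠ 0 := by
  intro h
  let L := FractionRing R
  let f : M →ₗ[R] ι → L := (Algebra.linearMap R L).compLeft ι ∘ₗ b.equivFun.toLinearMap
  have hf : Function.Injective f :=
    (IsFractionRing.injective R L).comp_left.comp b.equivFun.injective
  have hL : LinearIndependent L (f ∘ v) :=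
    (LinearIndependent.iff_fractionRing R L).1 (hv.map' f (LinearMap.ker_eq_bot.2 hf))
  -- the coordinates of `q` are linear forms dual to the vectors `f (v i)`, and the alternating map
  -- `w` formed with their determinant takes the value `1` at `v`
  obtain ⟨q, hq⟩ := (Fintype.linearCombination L (f ∘ v)).exists_leftInverse_of_injective
    (LinearMap.ker_eq_bot.2 hL.fintypeLinearCombination_injective)
  have hq' : ∀ i, q (f (v i)) = Pi.single i 1 := by
    intro i
    have h1 := LinearMap.congr_fun hq (Pi.single i 1)
    simpa using h1
  let D : (Fin k → L) [⋀^Fin k]→ₗ[R] L :=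
    { (Matrix.detRowAlternating (R := L) (n := Fin k)).toMultilinearMap.restrictScalars R with
      map_eq_zero_of_eq' := Matrix.detRowAlternating.map_eq_zero_of_eq' }
  let w : M [⋀^Fin k]→ₗ[R] L := D.compLinearMap (q.restrictScalars R ∘ₗ f)
  have h2 := alternatingMapLinearEquiv_apply_ιMulti w v
  rw [h, map_zero] at h2
  have h3 : w v = 1 := by
    have h4 : (Matrix.of fun i => q (f (v i))) = 1 := by
      ext i j
      rw [Matrix.of_apply, hq', Matrix.one_apply, Pi.single_apply]
      simp only [eq_comm]
    exact (congrArg Matrix.det h4).trans Matrix.det_one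
  exact zero_ne_one (h2.trans h3)


end exteriorPower

/-! ### Points and bases of an algebra scheme -/

section LeftMulMatrix

open Algebra

variable {ι R A : Type*} [Fintype ι] [DecidableEq ι] [CommRing R] [Ring A] [Algebra R A]
  (b : Module.Basis ι R A)

lemma sum_repr_smul_leftMulMatrix (a : A) :
    ∑ i, b.repr a i • leftMulMatrix b (b i) = leftMulMatrix b a := by
  conv_rhs => rw [← b.sum_repr a, map_sum]
  simp only [map_smul]

lemma leftMulMatrix_basis_mul (i j : ι) : leftMulMatrix b (b i) * leftMulMatrix b (b j) =
    ∑ k, leftMulMatrix b (b i) k j • leftMulMatrix b (b k) := by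
  rw [← map_mul, ← sum_repr_smul_leftMulMatrix]
  simp only [leftMulMatrix_eq_repr_mul]

/-- The matrix of left multiplication by a basis vector takes the coordinates of the unit to the
coordinates of that vector. -/
lemma leftMulMatrix_basis_mulVec_repr_one (i : ι) :
    (leftMulMatrix b (b i)).mulVec (b.repr 1) = Pi.single i 1 := by
  rw [leftMulMatrix_mulVec_repr, mul_one, b.repr_self]
  ext k
  rw [Finsupp.single_eq_pi_single]

lemma toMatrix_mul_leftMulMatrix {κ : Type*} [Fintype κ] [DecidableEq κ]
    (b' : Module.Basis κ R A) (i : ι) :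
    b'.toMatrix b * leftMulMatrix b (b i) =
      (∑ k, b'.toMatrix b k i • leftMulMatrix b' (b' k)) * b'.toMatrix b := by
  have h : ∑ k, b'.toMatrix b k i • leftMulMatrix b' (b' k) = leftMulMatrix b' (b i) :=
    sum_repr_smul_leftMulMatrix b' (b i)
  rw [h, leftMulMatrix_apply, leftMulMatrix_apply, basis_toMatrix_mul_linearMap_toMatrix,
    linearMap_toMatrix_mul_basis_toMatrix]

end LeftMulMatrix

namespace GaAlgebraScheme

variable {S : Scheme.{u}} {A : GaAlgebraScheme S}

section Points

variable {T T' T'' : Over S}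

/-- Pullback of points along `g`, as a ring homomorphism. -/
def pullHom (A : GaAlgebraScheme S) (g : T' ⟶ T) : A.Pt T →+* A.Pt T' where
  toFun a := a.pull g
  map_one' := A.comp_one g
  map_mul' := A.comp_mul g
  map_zero' := by
    have h : (0 + 0 : A.Pt T).pull g = (0 : A.Pt T).pull g + (0 : A.Pt T).pull g :=
      A.comp_add g (0 : A.Pt T) (0 : A.Pt T)
    rw [add_zero] at h
    exact left_eq_add.1 h
  map_add' := A.comp_add g

/-- The ring homomorphism `Γ(T, 𝒪_T) → Γ(T', 𝒪_T')` given by a morphism `T' ⟶ T` over `S`. -/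
def funHom (g : T' ⟶ T) : Γ(T.left, ⊤) →+* Γ(T'.left, ⊤) := g.left.appTop.hom

@[simp] lemma pullHom_apply (g : T' ⟶ T) (a : A.Pt T) : A.pullHom g a = a.pull g := rfl

lemma pull_smul (g : T' ⟶ T) (c : Γ(T.left, ⊤)) (a : A.Pt T) :
    (c • a).pull g = funHom g c • a.pull g := A.comp_smul g c a

lemma pull_sum_smul {ι : Type*} (s : Finset ι) (g : T' ⟶ T) (c : ι → Γ(T.left, ⊤))
    (a : ι → A.Pt T) :
    (∑ i ∈ s, c i • a i).pull g = ∑ i ∈ s, funHom g (c i) • (a i).pull g := by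
  rw [← pullHom_apply, map_sum]
  simp only [pullHom_apply, pull_smul]

lemma pull_pull (g : T' ⟶ T) (h : T'' ⟶ T') (a : A.Pt T) :
    (a.pull g).pull h = a.pull (h ≫ g) := (Category.assoc _ _ _).symm

lemma funHom_comp (g : T' ⟶ T) (h : T'' ⟶ T') : funHom (h ≫ g) = (funHom h).comp (funHom g) := by
  change (h.left ≫ g.left).appTop.hom = _
  rw [Scheme.Hom.comp_appTop]
  rfl

lemma funHom_id : funHom (𝟙 T) = RingHom.id _ := by
  simp [funHom]

lemma val_pull (g : T' ⟶ T) (a : A.Pt T) (δ : Γ(A.X.left, ⊤)) :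
    (a.pull g).val δ = funHom g (a.val δ) := by
  change (g.left ≫ (show T ⟶ A.X from a).left).appTop.hom δ = _
  rw [Scheme.Hom.comp_appTop]
  rfl

lemma pull_algebraMap (g : T' ⟶ T) (c : Γ(T.left, ⊤)) :
    (algebraMap _ (A.Pt T) c).pull g = algebraMap _ (A.Pt T') (funHom g c) := by
  rw [Algebra.algebraMap_eq_smul_one, Algebra.algebraMap_eq_smul_one, pull_smul]
  congr 1
  exact A.comp_one g

end Points

section Basis

variable {U : S.Opens} {n : ℕ} {e : Fin n → A.Pt (Over.mk U.ι)}

/-- The basis of the module of `T`-valued points defined by a basis of `A` over `U`, for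
`T` over `U`. -/
noncomputable def IsBasisOver.basis (hB : A.IsBasisOver U e) {T : Over S} (g : T ⟶ Over.mk U.ι) :
    Module.Basis (Fin n) Γ(T.left, ⊤) (A.Pt T) :=
  Module.Basis.ofEquivFun (LinearEquiv.ofBijective
    (Fintype.linearCombination Γ(T.left, ⊤) fun i => (e i).pull g) (by
      rw [Function.bijective_iff_existsUnique]
      intro a
      simp only [Fintype.linearCombination_apply, eq_comm (b := a)]
      exact hB T g a)).symm

lemma IsBasisOver.basis_apply (hB : A.IsBasisOver U e) {T : Over S} (g : T ⟶ Over.mk U.ι)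
    (i : Fin n) : hB.basis g i = (e i).pull g := by
  simp [IsBasisOver.basis, Fintype.linearCombination_apply, Pi.single_apply]

lemma IsBasisOver.sum_repr (hB : A.IsBasisOver U e) {T : Over S} (g : T ⟶ Over.mk U.ι)
    (a : A.Pt T) : ∑ i, (hB.basis g).repr a i • (e i).pull g = a := by
  conv_rhs => rw [← (hB.basis g).sum_repr a]
  simp only [hB.basis_apply]

lemma IsBasisOver.repr_sum (hB : A.IsBasisOver U e) {T : Over S} (g : T ⟶ Over.mk U.ι)
    (x : Fin n → Γ(T.left, ⊤)) :
    ((hB.basis g).repr (∑ i, x i • (e i).pull g) : Fin n → _) = x := by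
  simp only [← hB.basis_apply]
  exact (hB.basis g).repr_sum_self x

lemma IsBasisOver.repr_pull (hB : A.IsBasisOver U e) {T T' : Over S} (g : T ⟶ Over.mk U.ι)
    (h : T' ⟶ T) (a : A.Pt T) (i : Fin n) :
    (hB.basis (h ≫ g)).repr (a.pull h) i = funHom h ((hB.basis g).repr a i) := by
  have h1 := congrArg (fun a => Pt.pull a h) (hB.sum_repr g a)
  simp only [pull_sum_smul, pull_pull] at h1
  rw [← h1, hB.repr_sum]

lemma IsBasisOver.leftMulMatrix_pull (hB : A.IsBasisOver U e) {T T' : Over S}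
    (g : T ⟶ Over.mk U.ι) (h : T' ⟶ T) (a : A.Pt T) :
    Algebra.leftMulMatrix (hB.basis (h ≫ g)) (a.pull h) =
      (Algebra.leftMulMatrix (hB.basis g) a).map (funHom h) := by
  ext i j
  rw [Matrix.map_apply, Algebra.leftMulMatrix_eq_repr_mul, Algebra.leftMulMatrix_eq_repr_mul,
    ← hB.repr_pull, hB.basis_apply, hB.basis_apply, ← pull_pull]
  rw [← pullHom_apply, ← pullHom_apply, ← map_mul]
  rfl

/-- The matrices of left multiplication by the elements of a basis of `A` over `U`. -/
noncomputable def IsBasisOver.mulMatrix (hB : A.IsBasisOver U e) (i : Fin n) :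
    Matrix (Fin n) (Fin n) Γ((Over.mk U.ι).left, ⊤) :=
  Algebra.leftMulMatrix (hB.basis (𝟙 _)) (hB.basis (𝟙 _) i)

/-- The coordinates of the unit of `A` in a basis of `A` over `U`. -/
noncomputable def IsBasisOver.unitCoord (hB : A.IsBasisOver U e) (i : Fin n) :
    Γ((Over.mk U.ι).left, ⊤) :=
  (hB.basis (𝟙 _)).repr 1 i

open GenericElement

lemma IsBasisOver.sum_unitCoord (hB : A.IsBasisOver U e) :
    ∑ i, hB.unitCoord i • hB.mulMatrix i = 1 :=
  (sum_repr_smul_leftMulMatrix _ 1).trans (map_one _)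

lemma IsBasisOver.mulMatrix_mul (hB : A.IsBasisOver U e) (i j : Fin n) :
    hB.mulMatrix i * hB.mulMatrix j = ∑ k, hB.mulMatrix i k j • hB.mulMatrix k :=
  leftMulMatrix_basis_mul _ i j

lemma IsBasisOver.mulMatrix_mulVec (hB : A.IsBasisOver U e) (i : Fin n) :
    (hB.mulMatrix i).mulVec hB.unitCoord = Pi.single i 1 :=
  leftMulMatrix_basis_mulVec_repr_one _ i

lemma IsBasisOver.leftMulMatrix_basis (hB : A.IsBasisOver U e) {T : Over S}
    (g : T ⟶ Over.mk U.ι) (i : Fin n) :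
    Algebra.leftMulMatrix (hB.basis g) (hB.basis g i) = (hB.mulMatrix i).map (funHom g) := by
  rw [IsBasisOver.mulMatrix, ← hB.leftMulMatrix_pull, hB.basis_apply, hB.basis_apply, pull_pull]
  simp only [Category.comp_id]

/-- Left multiplication by a point is the linear combination, with the coordinates of the point as
coefficients, of the matrices of left multiplication by the basis. -/
lemma IsBasisOver.leftMulMatrix_eq_evalAt (hB : A.IsBasisOver U e) {T : Over S}
    (g : T ⟶ Over.mk U.ι) (a : A.Pt T) :
    Algebra.leftMulMatrix (hB.basis g) a =
      evalAt (funHom g) hB.mulMatrix ((hB.basis g).repr a) := by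
  rw [← sum_repr_smul_leftMulMatrix, evalAt]
  simp only [hB.leftMulMatrix_basis]

lemma IsBasisOver.repr_one (hB : A.IsBasisOver U e) {T : Over S} (g : T ⟶ Over.mk U.ι)
    (i : Fin n) : (hB.basis g).repr 1 i = funHom g (hB.unitCoord i) := by
  rw [IsBasisOver.unitCoord, ← hB.repr_pull, ← pullHom_apply, map_one (A.pullHom g)]
  simp only [Category.comp_id]

lemma IsBasisOver.repr_mul (hB : A.IsBasisOver U e) {T : Over S} (g : T ⟶ Over.mk U.ι)
    (a b : A.Pt T) : ((hB.basis g).repr (a * b) : Fin n → _) =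
      (evalAt (funHom g) hB.mulMatrix ((hB.basis g).repr a)).mulVec ((hB.basis g).repr b) := by
  rw [← hB.leftMulMatrix_eq_evalAt, Algebra.leftMulMatrix_mulVec_repr]

end Basis

end GaAlgebraScheme

/-! ### Open subschemes and the function field -/

namespace AlgebraicGeometry

lemma homOfLE_appTop_topIso {X : Scheme.{u}} {W U : X.Opens} (h : W ≤ U) :
    (X.homOfLE h).appTop ≫ W.topIso.hom = U.topIso.hom ≫ X.presheaf.map (homOfLE h).op := by
  rw [Scheme.homOfLE_appTop, Scheme.Opens.topIso_hom, Scheme.Opens.topIso_hom]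
  refine (X.presheaf.map_comp _ _).symm.trans (Eq.trans ?_ (X.presheaf.map_comp _ _))
  exact congrArg X.presheaf.map (Subsingleton.elim _ _)

end AlgebraicGeometry

namespace GaAlgebraScheme

variable {S : Scheme.{u}} {A : GaAlgebraScheme S}

/-- The inclusion of open subschemes, as a morphism over `S`. -/
noncomputable def resHom {W U : S.Opens} (h : W ≤ U) : Over.mk W.ι ⟶ Over.mk U.ι :=
  Over.homMk (S.homOfLE h) (by simp)

/-- An `S`-scheme lies over an open subscheme of `S` in at most one way. -/
instance (T : Over S) (U : S.Opens) : Subsingleton (T ⟶ Over.mk U.ι) where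
  allEq f g := by
    ext1
    rw [← cancel_mono U.ι]
    exact (Over.w f).trans (Over.w g).symm

/-- The factorization of an `S`-scheme through an open subscheme of `S`. -/
noncomputable def liftOpen (T : Over S) (U : S.Opens) (h : Set.range T.hom ⊆ U) :
    T ⟶ Over.mk U.ι :=
  Over.homMk (IsOpenImmersion.lift U.ι T.hom (by simpa using h)) (IsOpenImmersion.lift_fac _ _ _)

section FunctionField

variable [IsIntegral S]

/-- The inclusion of the functions on a nonempty open subscheme into the function field. -/
noncomputable def toFunctionField (U : S.Opens) [Nonempty U] :
    Γ((Over.mk U.ι).left, ⊤) →+* S.functionField :=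
  (S.germToFunctionField U).hom.comp U.topIso.hom.hom

lemma toFunctionField_injective (U : S.Opens) [Nonempty U] :
    Function.Injective (toFunctionField U) := by
  have h1 := S.germToFunctionField_injective U
  have h2 : Function.Injective U.topIso.hom.hom :=
    (U.topIso.commRingCatIsoToRingEquiv).injective
  exact h1.comp h2

lemma toFunctionField_comp_funHom {W U : S.Opens} [Nonempty W] [Nonempty U] (h : W ≤ U) :
    (toFunctionField W).comp (funHom (resHom h)) = toFunctionField U := by
  have h1 : (S.homOfLE h).appTop ≫ W.topIso.hom ≫ S.germToFunctionField W =
      U.topIso.hom ≫ S.germToFunctionField U := by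
    rw [← Category.assoc, homOfLE_appTop_topIso, Category.assoc]
    congr 1
    exact TopCat.Presheaf.germ_res _ _ _ _
  exact congrArg CommRingCat.Hom.hom h1

/-- The ring of functions on an affine open subscheme of a normal integral scheme is integrally
closed, since its localizations at maximal ideals are stalks. -/
lemma isIntegrallyClosed_of_isAffineOpen
    (hS : ∀ s : S, IsIntegrallyClosed (S.presheaf.stalk s)) (U : S.Opens) (hU : IsAffineOpen U)
    [Nonempty U] : IsIntegrallyClosed Γ(S, U) := by
  refine IsIntegrallyClosed.of_localization_maximal fun p _ hp => ?_
  set y : PrimeSpectrum Γ(S, U) := ⟨p, hp.isPrime⟩ with hy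
  have hyU : hU.fromSpec y ∈ U := by
    have : hU.fromSpec y ∈ Set.range hU.fromSpec := ⟨_, rfl⟩
    rwa [hU.range_fromSpec] at this
  let : Algebra Γ(S, U) (S.presheaf.stalk (hU.fromSpec y)) :=
    TopCat.Presheaf.algebra_section_stalk S.presheaf ⟨_, hyU⟩
  have : IsLocalization p.primeCompl (S.presheaf.stalk (hU.fromSpec y)) :=
    hU.isLocalization_stalk' y hyU
  have := hS (hU.fromSpec y)
  exact IsIntegrallyClosed.of_equiv (IsLocalization.algEquiv p.primeCompl
    (S.presheaf.stalk (hU.fromSpec y)) (Localization.AtPrime p)).toRingEquiv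

variable {U : S.Opens} {n : ℕ} {e : Fin n → A.Pt (Over.mk U.ι)}

open GenericElement

/-- The generic degree of `A`, computed in a basis over a nonempty open subscheme. -/
noncomputable def IsBasisOver.degree [Nonempty U] (hB : A.IsBasisOver U e) : ℕ :=
  genericDegree (fun i => (hB.mulMatrix i).map (toFunctionField U))

/-- By normality, the generic determinant of `A` over the function field has coefficients in the
ring of functions on `U`. -/
lemma IsBasisOver.exists_isGenericDet [Nonempty U]
    (hS : ∀ s : S, IsIntegrallyClosed (S.presheaf.stalk s)) (hU : IsAffineOpen U)
    (hB : A.IsBasisOver U e) : ∃ F, IsGenericDet (toFunctionField U) hB.mulMatrix F := by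
  let : Algebra Γ((Over.mk U.ι).left, ⊤) S.functionField := (toFunctionField U).toAlgebra
  have : IsDomain Γ((Over.mk U.ι).left, ⊤) := (toFunctionField_injective U).isDomain _
  have : IsIntegrallyClosed Γ((Over.mk U.ι).left, ⊤) := by
    have := isIntegrallyClosed_of_isAffineOpen hS U hU
    exact IsIntegrallyClosed.of_equiv U.topIso.commRingCatIsoToRingEquiv.symm
  have : IsFractionRing Γ((Over.mk U.ι).left, ⊤) S.functionField := by
    have : IsLocalization (nonZeroDivisors Γ(S, U)) S.functionField :=
      functionField_isFractionRing_of_isAffineOpen S U hU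
    have := IsLocalization.isLocalization_of_base_ringEquiv (nonZeroDivisors Γ(S, U))
      S.functionField U.topIso.commRingCatIsoToRingEquiv.symm
    have h := MulEquivClass.map_nonZeroDivisors U.topIso.commRingCatIsoToRingEquiv.symm
    rw [h] at this
    exact this
  obtain ⟨F, hF⟩ := exists_map_eq_genericDet (K := S.functionField) hB.mulMatrix
  exact ⟨F, toFunctionField_injective U, hF⟩

lemma nonempty_inf (U V : S.Opens) [hU : Nonempty U] [hV : Nonempty V] :
    Nonempty (U ⊓ V : S.Opens) := by
  obtain ⟨x, hx⟩ := hU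
  obtain ⟨y, hy⟩ := hV
  obtain ⟨z, hz⟩ := nonempty_preirreducible_inter U.isOpen V.isOpen ⟨x, hx⟩ ⟨y, hy⟩
  exact ⟨z, hz⟩

variable {V : S.Opens} {m : ℕ} {f : Fin m → A.Pt (Over.mk V.ι)}

/-- The generic degree does not depend on the open subscheme nor on the basis, and the generic
determinants in two bases define the same function on the part of `A` over the intersection. Both
follow from the invariance under a change of basis, over the intersection. -/
lemma degree_eq_and_eval₂_eq [Nonempty U] [Nonempty V] (hB : A.IsBasisOver U e)
    (hC : A.IsBasisOver V f) {F : MvPolynomial (Fin n) Γ((Over.mk U.ι).left, ⊤)}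
    {G : MvPolynomial (Fin m) Γ((Over.mk V.ι).left, ⊤)}
    (hF : IsGenericDet (toFunctionField U) hB.mulMatrix F)
    (hG : IsGenericDet (toFunctionField V) hC.mulMatrix G) :
    hB.degree = hC.degree ∧ ∀ (T : Over S) (g : T ⟶ Over.mk U.ι) (h : T ⟶ Over.mk V.ι) (a : A.Pt T),
      F.eval₂ (funHom g) ((hB.basis g).repr a) = G.eval₂ (funHom h) ((hC.basis h).repr a) := by
  have := nonempty_inf U V
  set W : S.Opens := U ⊓ V with hW
  set rU : Over.mk W.ι ⟶ Over.mk U.ι := resHom inf_le_left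
  set rV : Over.mk W.ι ⟶ Over.mk V.ι := resHom inf_le_right
  have hρU : (toFunctionField W).comp (funHom rU) = toFunctionField U :=
    toFunctionField_comp_funHom _
  have hρV : (toFunctionField W).comp (funHom rV) = toFunctionField V :=
    toFunctionField_comp_funHom _
  have hMU : ∀ i, Algebra.leftMulMatrix (hB.basis rU) (hB.basis rU i) =
    (hB.mulMatrix i).map (funHom rU) := hB.leftMulMatrix_basis rU
  have hMV : ∀ i, Algebra.leftMulMatrix (hC.basis rV) (hC.basis rV i) =
    (hC.mulMatrix i).map (funHom rV) := hC.leftMulMatrix_basis rV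
  have hmU : ∀ i, ((hB.mulMatrix i).map (funHom rU)).map (toFunctionField W) =
      (hB.mulMatrix i).map (toFunctionField U) := by
    intro i; rw [← hρU]; rfl
  have hmV : ∀ i, ((hC.mulMatrix i).map (funHom rV)).map (toFunctionField W) =
      (hC.mulMatrix i).map (toFunctionField V) := by
    intro i; rw [← hρV]; rfl
  have hFW : IsGenericDet (toFunctionField W) (fun i => (hB.mulMatrix i).map (funHom rU))
      (MvPolynomial.map (funHom rU) F) :=
    ⟨toFunctionField_injective W, by
      rw [MvPolynomial.map_map, hρU, hF.map_eq]; simp only [hmU]⟩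
  have hGW : IsGenericDet (toFunctionField W) (fun i => (hC.mulMatrix i).map (funHom rV))
      (MvPolynomial.map (funHom rV) G) :=
    ⟨toFunctionField_injective W, by
      rw [MvPolynomial.map_map, hρV, hG.map_eq]; simp only [hmV]⟩
  have key := fun (B : Type u) [CommRing B] => eval₂_eq_of_intertwine (B := B) hFW hGW
    (S := (hC.basis rV).toMatrix (hB.basis rU)) (S' := (hB.basis rU).toMatrix (hC.basis rV))
    (Module.Basis.toMatrix_mul_toMatrix_flip _ _) (Module.Basis.toMatrix_mul_toMatrix_flip _ _)
    (fun i => by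
      have := toMatrix_mul_leftMulMatrix (hB.basis rU) (hC.basis rV) i
      simpa only [hMU, hMV] using this)
    (fun i => by
      have := toMatrix_mul_leftMulMatrix (hC.basis rV) (hB.basis rU) i
      simpa only [hMU, hMV] using this)
  refine ⟨?_, fun T g h a => ?_⟩
  -- over the intersection itself, `key` compares the degrees
  · have := (key Γ((Over.mk W.ι).left, ⊤)).1
    simp only [hmU, hmV] at this
    exact this
  -- `T` lies over the intersection of `U` and `V`
  obtain ⟨k⟩ : Nonempty (T ⟶ Over.mk W.ι) := ⟨liftOpen T W (by
    rintro _ ⟨t, rfl⟩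
    have h1 : T.hom = g.left ≫ U.ι := (Over.w g).symm
    have h2 : T.hom = h.left ≫ V.ι := (Over.w h).symm
    refine ⟨?_, ?_⟩
    · rw [h1, Scheme.Hom.comp_apply]
      exact (g.left t).2
    · rw [h2, Scheme.Hom.comp_apply]
      exact (h.left t).2)⟩
  obtain rfl : g = k ≫ rU := Subsingleton.elim _ _
  obtain rfl : h = k ≫ rV := Subsingleton.elim _ _
  have h1 := (key Γ(T.left, ⊤)).2 (funHom k) ((hB.basis (k ≫ rU)).repr a)
  have h2 : ((hC.basis rV).toMatrix (hB.basis rU)).map (funHom k) =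
      (hC.basis (k ≫ rV)).toMatrix (hB.basis (k ≫ rU)) := by
    ext i j
    simp only [Matrix.map_apply, Module.Basis.toMatrix_apply, hB.basis_apply, ← pull_pull,
      hC.repr_pull]
  rw [h2, Module.Basis.toMatrix_mulVec_repr, MvPolynomial.eval₂_map, MvPolynomial.eval₂_map,
    ← funHom_comp, ← funHom_comp] at h1
  exact h1.symm

end FunctionField

end GaAlgebraScheme

/-! ### Charts and gluing -/

namespace AlgebraicGeometry

section Glue

variable {X : Scheme.{u}}

lemma ι_appTop_topIso (U : X.Opens) :
    U.ι.appTop ≫ U.topIso.hom = X.presheaf.map (homOfLE le_top).op := by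
  rw [Scheme.Opens.ι_appTop, Scheme.Opens.topIso_hom]
  refine (X.presheaf.map_comp _ _).symm.trans ?_
  exact congrArg X.presheaf.map (Subsingleton.elim _ _)

variable {I : Type*} (V : I → X.Opens)

/-- Functions that agree on the members of an open covering are equal. -/
lemma eq_of_ι_appTop_eq (hV : ∀ x : X, ∃ i, x ∈ V i) (c c' : Γ(X, ⊤))
    (h : ∀ i, (V i).ι.appTop.hom c = (V i).ι.appTop.hom c') : c = c' := by
  refine X.sheaf.eq_of_locally_eq' V ⊤ (fun i => homOfLE le_top) (fun x _ => ?_) c c' fun i => ?_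
  · obtain ⟨i, hi⟩ := hV x
    exact TopologicalSpace.Opens.mem_iSup.2 ⟨i, hi⟩
  · have h1 := congrArg (V i).topIso.hom.hom (h i)
    have h2 : ∀ c, (V i).topIso.hom.hom ((V i).ι.appTop.hom c) =
        (X.presheaf.map (homOfLE le_top).op).hom c := by
      intro c
      rw [← ι_appTop_topIso]
      rfl
    rw [h2, h2] at h1
    exact h1

/-- Functions on the members of an open covering that agree on the intersections glue. -/
lemma exists_ι_appTop_eq (hV : ∀ x : X, ∃ i, x ∈ V i) (s : ∀ i, Γ((V i).toScheme, ⊤))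
    (h : ∀ i j, (X.homOfLE (inf_le_left : V i ⊓ V j ≤ V i)).appTop.hom (s i) =
      (X.homOfLE (inf_le_right : V i ⊓ V j ≤ V j)).appTop.hom (s j)) :
    ∃ c : Γ(X, ⊤), ∀ i, (V i).ι.appTop.hom c = s i := by
  have h0 : ∀ {W U : X.Opens} (h : W ≤ U) (c : Γ(U.toScheme, ⊤)),
      (X.presheaf.map (homOfLE h).op).hom (U.topIso.hom.hom c) =
        W.topIso.hom.hom ((X.homOfLE h).appTop.hom c) := by
    intro W U h c
    exact (congrArg (fun f => CommRingCat.Hom.hom f c) (homOfLE_appTop_topIso h)).symm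
  obtain ⟨c, hc, -⟩ := X.sheaf.existsUnique_gluing' V ⊤ (fun i => homOfLE le_top) (fun x _ => by
    obtain ⟨i, hi⟩ := hV x
    exact TopologicalSpace.Opens.mem_iSup.2 ⟨i, hi⟩) (fun i => (V i).topIso.hom.hom (s i)) (by
      intro i j
      refine (h0 inf_le_left (s i)).trans (Eq.trans ?_ (h0 inf_le_right (s j)).symm)
      rw [h i j])
  refine ⟨c, fun i => ?_⟩
  apply ((V i).topIso.commRingCatIsoToRingEquiv).injective
  refine Eq.trans ?_ (hc i)
  exact congrArg (fun f => CommRingCat.Hom.hom f c) (ι_appTop_topIso (V i))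

end Glue

end AlgebraicGeometry

namespace GaAlgebraScheme

variable {S : Scheme.{u}} {A : GaAlgebraScheme S}

open GenericElement

/-- A nonempty affine open subscheme of `S` with a basis of `A` over it. The number of elements of
the basis belongs to the data, so that charts exist independently of any global rank. -/
structure Chart (A : GaAlgebraScheme S) where
  /-- the open subscheme -/
  U : S.Opens
  isAffineOpen : IsAffineOpen U
  nonempty : Nonempty U
  /-- the number of elements of the basis -/
  n : ℕ
  /-- the basis -/
  e : Fin n → A.Pt (Over.mk U.ι)
  isBasisOver : A.IsBasisOver U e

instance (c : A.Chart) : Nonempty c.U := c.nonempty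

lemma IsBasisOver.restrict {U W : S.Opens} {n : ℕ} {e : Fin n → A.Pt (Over.mk U.ι)}
    (hB : A.IsBasisOver U e) (h : W ≤ U) : A.IsBasisOver W (fun i => (e i).pull (resHom h)) := by
  intro T g a
  simp only [pull_pull]
  exact hB T (g ≫ resHom h) a

lemma IsOfDim.exists_chart {n : ℕ} (hA : A.IsOfDim n) (s : S) : ∃ c : A.Chart, s ∈ c.U := by
  obtain ⟨U, e, hs, hB⟩ := hA s
  obtain ⟨W, hW, hsW, hWU⟩ := TopologicalSpace.Opens.isBasis_iff_nbhd.1 S.isBasis_affineOpens hs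
  exact ⟨⟨W, hW, ⟨s, hsW⟩, n, _, hB.restrict hWU⟩, hsW⟩

/-- An open subscheme of an `S`-scheme, as an `S`-scheme. -/
noncomputable abbrev openOver (T : Over S) (V : T.left.Opens) : Over S := Over.mk (V.ι ≫ T.hom)

/-- The inclusion of an open subscheme of an `S`-scheme. -/
noncomputable def openHom (T : Over S) (V : T.left.Opens) : openOver T V ⟶ T := Over.homMk V.ι

lemma pt_ext_of_openHom {T : Over S} {I : Type*} (V : I → T.left.Opens)
    (hV : ∀ x : T.left, ∃ i, x ∈ V i) (a b : A.Pt T)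
    (h : ∀ i, a.pull (openHom T (V i)) = b.pull (openHom T (V i))) : a = b := by
  apply Over.OverMorphism.ext
  refine (T.left.openCoverOfIsOpenCover V (TopologicalSpace.IsOpenCover.mk ?_)).hom_ext _ _
    fun i => ?_
  · exact top_le_iff.1 fun x _ => TopologicalSpace.Opens.mem_iSup.2 (hV x)
  · exact congrArg (fun f => CommaMorphism.left f) (h i)

section Local

/-- The affine open subschemes of `T` that lie over a chart. -/
structure LocalChart (A : GaAlgebraScheme S) (T : Over S) where
  /-- the affine open subscheme of `T` -/
  V : T.left.Opens
  isAffine : IsAffineOpen V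
  /-- the chart -/
  c : A.Chart
  /-- the structure morphism, factored through the chart -/
  hom : openOver T V ⟶ Over.mk c.U.ι

lemma exists_localChart (hA : ∀ s : S, ∃ c : A.Chart, s ∈ c.U) (T : Over S) (t : T.left) :
    ∃ l : A.LocalChart T, t ∈ l.V := by
  obtain ⟨c, hc⟩ := hA (T.hom t)
  obtain ⟨W, hW, hsW, hWU⟩ := TopologicalSpace.Opens.isBasis_iff_nbhd.1
    T.left.isBasis_affineOpens (show t ∈ (T.hom ⁻¹ᵁ c.U) from hc)
  refine ⟨⟨W, hW, c, liftOpen _ _ ?_⟩, hsW⟩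
  rintro _ ⟨x, rfl⟩
  exact hWU x.2

/-- Functions on `T` are equal if they become equal on affine schemes over charts. -/
lemma fun_ext_of_chart (hA : ∀ s : S, ∃ c : A.Chart, s ∈ c.U) {T : Over S} (x y : Γ(T.left, ⊤))
    (h : ∀ (T' : Over S) [IsAffine T'.left] (k : T' ⟶ T) (c : A.Chart) (_ : T' ⟶ Over.mk c.U.ι),
      funHom k x = funHom k y) : x = y := by
  refine eq_of_ι_appTop_eq (fun l : A.LocalChart T => l.V) (exists_localChart hA T) x y fun l => ?_
  have : IsAffine (openOver T l.V).left := l.isAffine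
  exact h (openOver T l.V) (openHom T l.V) l.c l.hom

/-- `T`-valued points of `A` are equal if they become equal on affine schemes over charts. -/
lemma pt_ext_of_chart (hA : ∀ s : S, ∃ c : A.Chart, s ∈ c.U) {T : Over S} (a b : A.Pt T)
    (h : ∀ (T' : Over S) [IsAffine T'.left] (k : T' ⟶ T) (c : A.Chart) (_ : T' ⟶ Over.mk c.U.ι),
      a.pull k = b.pull k) : a = b := by
  refine pt_ext_of_openHom (fun l : A.LocalChart T => l.V) (exists_localChart hA T) a b fun l => ?_
  have : IsAffine (openOver T l.V).left := l.isAffine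
  exact h (openOver T l.V) (openHom T l.V) l.c l.hom

end Local

section Existence

variable [IsIntegral S]

/-- In every chart, the function `δ` is given by the generic determinant. This determines `δ`, and
it is the property through which existence and uniqueness of the determinant are proved. -/
def IsLocallyGenericDet (A : GaAlgebraScheme S) (δ : Γ(A.X.left, ⊤)) : Prop :=
  ∀ c : A.Chart, ∃ F, IsGenericDet (toFunctionField c.U) c.isBasisOver.mulMatrix F ∧
    ∀ (T : Over S) (g : T ⟶ Over.mk c.U.ι) (a : A.Pt T),
      a.val δ = F.eval₂ (funHom g) ((c.isBasisOver.basis g).repr a)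

/-- The generic determinants in the charts glue to a function on `A`. -/
lemma exists_isLocallyGenericDet (hS : ∀ s : S, IsIntegrallyClosed (S.presheaf.stalk s))
    (hA : ∀ s : S, ∃ c : A.Chart, s ∈ c.U) : ∃ δ, A.IsLocallyGenericDet δ := by
  choose F hF using fun c : A.Chart => c.isBasisOver.exists_isGenericDet hS c.isAffineOpen
  -- `V c` is the part of `A` over the chart `c`, and `a (V c)` is its universal point
  set V : A.Chart → A.X.left.Opens := fun c => A.X.hom ⁻¹ᵁ c.U with hV
  set g : ∀ c, openOver A.X (V c) ⟶ Over.mk c.U.ι := fun c => liftOpen _ _ (by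
    rintro _ ⟨x, rfl⟩
    exact x.2)
  set a : ∀ W : A.X.left.Opens, A.Pt (openOver A.X W) := fun W => openHom A.X W with ha
  set s : ∀ c, Γ((V c).toScheme, ⊤) := fun c =>
    (F c).eval₂ (funHom (g c)) ((c.isBasisOver.basis (g c)).repr (a (V c))) with hs
  have hpull : ∀ c {T : Over S} (k : T ⟶ openOver A.X (V c)),
      funHom k (s c) = (F c).eval₂ (funHom (k ≫ g c))
        ((c.isBasisOver.basis (k ≫ g c)).repr ((a (V c)).pull k)) := by
    intro c T k
    rw [hs, MvPolynomial.hom_eval₂, ← funHom_comp]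
    congr 1
    ext i
    rw [c.isBasisOver.repr_pull]
  obtain ⟨δ, hδ⟩ := exists_ι_appTop_eq V (fun x => hA (A.X.hom x)) s (by
    intro c c'
    set k : openOver A.X (V c ⊓ V c') ⟶ openOver A.X (V c) :=
      Over.homMk (A.X.left.homOfLE inf_le_left) (by simp)
    set k' : openOver A.X (V c ⊓ V c') ⟶ openOver A.X (V c') :=
      Over.homMk (A.X.left.homOfLE inf_le_right) (by simp)
    refine (hpull c k).trans (Eq.trans ?_ (hpull c' k').symm)
    have h1 : (a (V c)).pull k = (a (V c')).pull k' := by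
      apply Over.OverMorphism.ext
      exact (Scheme.homOfLE_ι _ (inf_le_left : V c ⊓ V c' ≤ V c)).trans
        (Scheme.homOfLE_ι _ (inf_le_right : V c ⊓ V c' ≤ V c')).symm
    rw [h1]
    exact (degree_eq_and_eval₂_eq c.isBasisOver c'.isBasisOver (hF c) (hF c')).2 _ _ _ _)
  refine ⟨δ, fun c => ⟨F c, hF c, fun T h b => ?_⟩⟩
  -- every point of `A` over the chart is a pullback of the universal point
  obtain ⟨k, rfl⟩ : ∃ k : T ⟶ openOver A.X (V c), (a (V c)).pull k = b := by
    have hb : (show T ⟶ A.X from b).left ≫ A.X.hom = T.hom := Over.w (show T ⟶ A.X from b)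
    have hr : Set.range (show T ⟶ A.X from b).left ⊆ Set.range (V c).ι := by
      rw [Scheme.Opens.range_ι]
      rintro _ ⟨t, rfl⟩
      change A.X.hom ((show T ⟶ A.X from b).left t) ∈ c.U
      rw [← Scheme.Hom.comp_apply, hb, ← Over.w h]
      exact (h.left t).2
    refine ⟨Over.homMk (IsOpenImmersion.lift (V c).ι _ hr) ?_, ?_⟩
    · change _ ≫ (V c).ι ≫ A.X.hom = _
      rw [IsOpenImmersion.lift_fac_assoc, hb]
    · apply Over.OverMorphism.ext
      exact IsOpenImmersion.lift_fac _ _ hr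
  obtain rfl : h = k ≫ g c := Subsingleton.elim _ _
  rw [← hpull, val_pull]
  congr 1
  exact hδ c

end Existence

end GaAlgebraScheme

/-! ### The polynomial `δ(X - a)` -/

namespace GaAlgebraScheme

variable {S : Scheme.{u}} {A : GaAlgebraScheme S}

open GenericElement Polynomial

section Line

/-- On global functions, `Spec Γ(X, 𝒪_X) ≅ X` is the canonical identification. -/
lemma isoSpec_inv_appTop_ΓSpecIso (X : Scheme.{u}) [IsAffine X] :
    X.isoSpec.inv.appTop ≫ (Scheme.ΓSpecIso Γ(X, ⊤)).hom = 𝟙 _ := by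
  rw [← Scheme.toSpecΓ_appTop, ← Scheme.Hom.comp_appTop]
  change (X.isoSpec.hom ≫ X.isoSpec.inv).appTop = _
  rw [Iso.hom_inv_id, Scheme.Hom.id_appTop]

lemma lineFun_lineProj (T : Over S) [IsAffine T.left] (c : Γ(T.left, ⊤)) :
    lineFun T (funHom (lineProj T) c) = C c := by
  have h : (Spec.map (CommRingCat.ofHom (C : Γ(T.left, ⊤) →+* Γ(T.left, ⊤)[X])) ≫
      T.left.isoSpec.inv).appTop ≫ (Scheme.ΓSpecIso _).hom =
      CommRingCat.ofHom (C : Γ(T.left, ⊤) →+* Γ(T.left, ⊤)[X]) := by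
    rw [Scheme.Hom.comp_appTop, Category.assoc, Scheme.ΓSpecIso_naturality, ← Category.assoc]
    exact (congrArg (· ≫ _) (isoSpec_inv_appTop_ΓSpecIso T.left)).trans (Category.id_comp _)
  exact congrArg (fun f => CommRingCat.Hom.hom f c) h

lemma specMap_mapRingHom_comp {T T' : Over S} [IsAffine T.left] [IsAffine T'.left] (k : T' ⟶ T) :
    Spec.map (CommRingCat.ofHom (mapRingHom (funHom k))) ≫
        Spec.map (CommRingCat.ofHom (C : Γ(T.left, ⊤) →+* Γ(T.left, ⊤)[X])) ≫ T.left.isoSpec.inv =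
      (Spec.map (CommRingCat.ofHom (C : Γ(T'.left, ⊤) →+* Γ(T'.left, ⊤)[X])) ≫
        T'.left.isoSpec.inv) ≫ k.left := by
  have h1 : CommRingCat.ofHom (C : Γ(T.left, ⊤) →+* Γ(T.left, ⊤)[X]) ≫
      CommRingCat.ofHom (mapRingHom (funHom k)) =
      k.left.appTop ≫ CommRingCat.ofHom (C : Γ(T'.left, ⊤) →+* Γ(T'.left, ⊤)[X]) := by
    ext c
    simp [funHom]
  have h2 : Spec.map k.left.appTop ≫ T.left.isoSpec.inv = T'.left.isoSpec.inv ≫ k.left :=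
    Scheme.isoSpec_inv_naturality _
  rw [← Spec.map_comp_assoc, h1, Spec.map_comp_assoc, h2, Category.assoc]

/-- The morphism of affine lines induced by a morphism of affine schemes. -/
noncomputable def lineMap {T T' : Over S} [IsAffine T.left] [IsAffine T'.left] (k : T' ⟶ T) :
    line T' ⟶ line T :=
  Over.homMk (Spec.map (CommRingCat.ofHom (mapRingHom (funHom k)))) (by
    have h := congrArg (· ≫ T.hom) (specMap_mapRingHom_comp k)
    simp only [Category.assoc, Over.w k] at h
    exact h)

lemma lineMap_lineProj {T T' : Over S} [IsAffine T.left] [IsAffine T'.left] (k : T' ⟶ T) :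
    lineMap k ≫ lineProj T = lineProj T' ≫ k := by
  ext1
  exact specMap_mapRingHom_comp k

lemma lineFun_lineMap {T T' : Over S} [IsAffine T.left] [IsAffine T'.left] (k : T' ⟶ T)
    (f : Γ((line T).left, ⊤)) :
    lineFun T' (funHom (lineMap k) f) = (lineFun T f).map (funHom k) := by
  have h := Scheme.ΓSpecIso_naturality (CommRingCat.ofHom (mapRingHom (funHom k)))
  exact congrArg (fun g => CommRingCat.Hom.hom g f) h

/-- The polynomial `δ(X - a)` is compatible with base change. -/
lemma charPoly_pull (δ : Γ(A.X.left, ⊤)) {T T' : Over S} [IsAffine T.left] [IsAffine T'.left]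
    (k : T' ⟶ T) (a : A.Pt T) :
    A.charPoly δ T' (a.pull k) = (A.charPoly δ T a).map (funHom k) := by
  rw [charPoly, charPoly, ← lineFun_lineMap, ← val_pull]
  congr 2
  refine Eq.trans ?_ (map_sub (A.pullHom (lineMap k)) _ _).symm
  rw [pullHom_apply, pullHom_apply, pull_algebraMap, pull_pull, pull_pull, lineMap_lineProj]
  congr 2
  apply (lineFun T').injective
  rw [lineFun_lineMap]
  simp

end Line

lemma pull_aeval {T T' : Over S} (k : T' ⟶ T) (a : A.Pt T) (p : Γ(T.left, ⊤)[X]) :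
    (aeval a p).pull k = aeval (a.pull k) (p.map (funHom k)) := by
  rw [← pullHom_apply, aeval_def, aeval_def, eval₂_map, Polynomial.hom_eval₂]
  congr 1
  ext c
  exact pull_algebraMap k c

section Basis

variable {U : S.Opens} {n : ℕ} {e : Fin n → A.Pt (Over.mk U.ι)}

/-- If the function `δ` is given by the polynomial `F` in a basis, then `δ(X - a)` is given by
`F(X u - x)`, where `u` and `x` are the coordinates of the unit and of `a`. -/
lemma charPoly_eq_shift (hB : A.IsBasisOver U e) {δ : Γ(A.X.left, ⊤)}
    {F : MvPolynomial (Fin n) Γ((Over.mk U.ι).left, ⊤)}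
    (hF : ∀ (T : Over S) (g : T ⟶ Over.mk U.ι) (a : A.Pt T),
      a.val δ = F.eval₂ (funHom g) ((hB.basis g).repr a))
    (T : Over S) [IsAffine T.left] (g : T ⟶ Over.mk U.ι) (a : A.Pt T) :
    A.charPoly δ T a = shift (funHom g) F (fun i => funHom g (hB.unitCoord i))
      ((hB.basis g).repr a) := by
  rw [charPoly, hF _ (lineProj T ≫ g), shift, ← RingEquiv.coe_toRingHom, MvPolynomial.hom_eval₂]
  congr 1
  · ext c : 1
    rw [funHom_comp]
    exact lineFun_lineProj T _
  · ext i : 1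
    rw [map_sub, Finsupp.sub_apply, map_sub, hB.repr_pull, Algebra.algebraMap_eq_smul_one, map_smul,
      Finsupp.smul_apply, hB.repr_one, smul_eq_mul, map_mul, funHom_comp]
    congr 1
    · congr 1
      · exact (lineFun T).apply_symm_apply Polynomial.X
      · exact lineFun_lineProj T _
    · exact lineFun_lineProj T _

lemma aeval_eq_zero_iff (hB : A.IsBasisOver U e) {T : Over S} (g : T ⟶ Over.mk U.ι) (a : A.Pt T)
    (p : Γ(T.left, ⊤)[X]) : aeval a p = 0 ↔
      aeval (evalAt (funHom g) hB.mulMatrix ((hB.basis g).repr a)) p = 0 := by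
  rw [← hB.leftMulMatrix_eq_evalAt, aeval_algHom_apply,
    map_eq_zero_iff _ (Algebra.leftMulMatrix_injective _)]

end Basis

/-! ### Properties of the determinant -/

section Properties

variable [IsIntegral S] {δ : Γ(A.X.left, ⊤)}

lemma IsLocallyGenericDet.isSymSection (hδ : A.IsLocallyGenericDet δ) {d : ℕ}
    (hd : ∀ c : A.Chart, c.isBasisOver.degree = d) : A.IsSymSection d δ := by
  intro U hU n e hB
  by_cases hne : Nonempty U
  · obtain ⟨F, hF, hval⟩ := hδ ⟨U, hU, hne, n, e, hB⟩
    refine ⟨F, ?_, fun T g x => ?_⟩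
    · rw [← hd ⟨U, hU, hne, n, e, hB⟩]
      exact hF.isHomogeneous
    · rw [hval T g, hB.repr_sum]
      rfl
  -- over the empty subscheme, all rings of functions vanish
  · refine ⟨0, MvPolynomial.isHomogeneous_zero _ _ _, fun T g x => ?_⟩
    have : IsEmpty T.left := ⟨fun t => hne ⟨g.left t⟩⟩
    exact Subsingleton.elim _ _

lemma IsLocallyGenericDet.isMonoidHom (hA : ∀ s : S, ∃ c : A.Chart, s ∈ c.U)
    (hδ : A.IsLocallyGenericDet δ) : A.IsMonoidHom δ := by
  refine fun T => ⟨?_, fun a b => ?_⟩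
  · refine fun_ext_of_chart hA _ _ fun T' _ k c g => ?_
    obtain ⟨F, hF, hval⟩ := hδ c
    have h1 : ((c.isBasisOver.basis g).repr (1 : A.Pt T') : Fin c.n → _) =
        fun i => funHom g (c.isBasisOver.unitCoord i) := funext fun i => c.isBasisOver.repr_one g i
    rw [← val_pull, ← pullHom_apply, map_one, map_one, hval T' g, h1]
    exact hF.eval₂_one c.isBasisOver.sum_unitCoord _
  · refine fun_ext_of_chart hA _ _ fun T' _ k c g => ?_
    obtain ⟨F, hF, hval⟩ := hδ c
    rw [map_mul, ← val_pull, ← val_pull, ← val_pull, ← pullHom_apply, map_mul, hval T' g,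
      hval T' g, hval T' g, c.isBasisOver.repr_mul]
    exact hF.eval₂_mul c.isBasisOver.sum_unitCoord c.isBasisOver.mulMatrix_mul
      c.isBasisOver.mulMatrix_mulVec _ _ _

lemma IsLocallyGenericDet.aeval_charPoly (hA : ∀ s : S, ∃ c : A.Chart, s ∈ c.U)
    (hδ : A.IsLocallyGenericDet δ) (T : Over S) [IsAffine T.left] (a : A.Pt T) :
    aeval a (A.charPoly δ T a) = 0 := by
  refine pt_ext_of_chart hA _ _ fun T' _ k c g => ?_
  obtain ⟨F, hF, hval⟩ := hδ c
  rw [pull_aeval, ← charPoly_pull, ← pullHom_apply (a := 0), map_zero,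
    aeval_eq_zero_iff c.isBasisOver g, charPoly_eq_shift c.isBasisOver hval T' g]
  exact hF.aeval_shift c.isBasisOver.sum_unitCoord _ _

/-- The polynomial `δ(X - a)` is monic of degree `d`, in a form that also makes sense over the
zero ring. -/
lemma IsLocallyGenericDet.charPoly_coeff (hA : ∀ s : S, ∃ c : A.Chart, s ∈ c.U)
    (hδ : A.IsLocallyGenericDet δ) {d : ℕ} (hd : ∀ c : A.Chart, c.isBasisOver.degree = d)
    (T : Over S) [IsAffine T.left] (a : A.Pt T) :
    (A.charPoly δ T a).coeff d = 1 ∧ (A.charPoly δ T a).natDegree ≤ d := by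
  constructor
  · refine fun_ext_of_chart hA _ _ fun T' _ k c g => ?_
    obtain ⟨F, hF, hval⟩ := hδ c
    rw [map_one, ← coeff_map, ← charPoly_pull, charPoly_eq_shift c.isBasisOver hval T' g, ← hd c]
    exact hF.shift_coeff c.isBasisOver.sum_unitCoord _ _
  · rw [natDegree_le_iff_coeff_eq_zero]
    intro j hj
    refine fun_ext_of_chart hA _ _ fun T' _ k c g => ?_
    obtain ⟨F, hF, hval⟩ := hδ c
    rw [map_zero, ← coeff_map, ← charPoly_pull, charPoly_eq_shift c.isBasisOver hval T' g]
    apply coeff_eq_zero_of_natDegree_lt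
    refine lt_of_le_of_lt ?_ hj
    rw [← hd c]
    exact (shift_natDegree_le_and_coeff hF.isHomogeneous _ _ _).1

lemma IsLocallyGenericDet.degLE (hA : ∀ s : S, ∃ c : A.Chart, s ∈ c.U)
    (hδ : A.IsLocallyGenericDet δ) {d : ℕ} (hd : ∀ c : A.Chart, c.isBasisOver.degree = d) :
    A.DegLE d := by
  intro T _ a
  obtain ⟨h1, h2⟩ := hδ.charPoly_coeff hA hd T a
  exact exteriorPower.ιMulti_pow_eq_zero a _ d h1 h2 (hδ.aeval_charPoly hA T a)

end Properties

end GaAlgebraScheme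

/-! ### The universal point -/

namespace GaAlgebraScheme

variable {S : Scheme.{u}} {A : GaAlgebraScheme S}

open GenericElement Polynomial

section GenericPoint

variable {U : S.Opens} {n : ℕ} {e : Fin n → A.Pt (Over.mk U.ι)}

/-- The universal point of `A` over an affine open `U` with a basis of `A`: its coordinates are the
indeterminates of a polynomial ring over the functions on `U`. -/
lemma exists_generic_point (hU : IsAffineOpen U) (hB : A.IsBasisOver U e) :
    ∃ (T : Over S) (_ : IsAffine T.left) (g : T ⟶ Over.mk U.ι)
      (θ : Γ(T.left, ⊤) ≃+* MvPolynomial (Fin n) Γ((Over.mk U.ι).left, ⊤)) (a : A.Pt T),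
      (∀ r, θ (funHom g r) = MvPolynomial.C r) ∧
        ∀ i, θ ((hB.basis g).repr a i) = MvPolynomial.X i := by
  have : IsAffine U.toScheme := hU
  set f : Spec (CommRingCat.of (MvPolynomial (Fin n) Γ(U.toScheme, ⊤))) ⟶ U.toScheme :=
    Spec.map (CommRingCat.ofHom
      (MvPolynomial.C : Γ(U.toScheme, ⊤) →+* MvPolynomial (Fin n) Γ(U.toScheme, ⊤))) ≫
      U.toScheme.isoSpec.inv with hf
  set g : Over.mk (f ≫ U.ι) ⟶ Over.mk U.ι := Over.homMk f rfl
  set θ : Γ((Over.mk (f ≫ U.ι)).left, ⊤) ≃+* MvPolynomial (Fin n) Γ((Over.mk U.ι).left, ⊤) :=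
    (Scheme.ΓSpecIso (CommRingCat.of
      (MvPolynomial (Fin n) Γ(U.toScheme, ⊤)))).commRingCatIsoToRingEquiv
  refine ⟨Over.mk (f ≫ U.ι), isAffine_Spec _, g, θ,
    ∑ i, θ.symm (MvPolynomial.X i) • (e i).pull g, fun r => ?_, fun i => ?_⟩
  · have h : f.appTop ≫ (Scheme.ΓSpecIso _).hom = CommRingCat.ofHom
        (MvPolynomial.C : Γ(U.toScheme, ⊤) →+* MvPolynomial (Fin n) Γ(U.toScheme, ⊤)) := by
      rw [hf, Scheme.Hom.comp_appTop, Category.assoc, Scheme.ΓSpecIso_naturality, ← Category.assoc]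
      exact (congrArg (· ≫ _) (isoSpec_inv_appTop_ΓSpecIso U.toScheme)).trans (Category.id_comp _)
    exact congrArg (fun f => CommRingCat.Hom.hom f r) h
  · rw [hB.repr_sum, RingEquiv.apply_symm_apply]

variable {T : Over S} {g : T ⟶ Over.mk U.ι}
  {θ : Γ(T.left, ⊤) ≃+* MvPolynomial (Fin n) Γ((Over.mk U.ι).left, ⊤)} {a : A.Pt T}

/-- The polynomial relations satisfied by the universal point are those of the generic matrix. -/
lemma aeval_eq_zero_iff_aeval_generic (hB : A.IsBasisOver U e)
    (hθ : ∀ r, θ (funHom g r) = MvPolynomial.C r)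
    (ha : ∀ i, θ ((hB.basis g).repr a i) = MvPolynomial.X i) (p : Γ(T.left, ⊤)[X]) :
    aeval a p = 0 ↔ aeval (generic hB.mulMatrix) (p.map θ.toRingHom) = 0 := by
  have h1 : (evalAt (funHom g) hB.mulMatrix ((hB.basis g).repr a)).map θ.toRingHom =
      generic hB.mulMatrix := by
    rw [evalAt_map, generic]
    congr 1
    · ext1 r
      exact hθ r
    · ext1 i
      exact ha i
  rw [aeval_eq_zero_iff hB g, ← h1, ← map_aeval_matrix]
  constructor
  · intro h
    rw [h]
    ext1
    simp
  · intro h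
    ext1 i j
    exact θ.injective ((congrFun (congrFun h i) j).trans (map_zero θ).symm)

end GenericPoint

/-! ### The degree -/

section Degree

variable [IsIntegral S]

/-- For `m` less than the generic degree, the powers `1, a, …, a ^ m` of the universal point are
linearly independent, hence have nonzero exterior product. -/
lemma DegLE.degree_le {m : ℕ} (h : A.DegLE m) (c : A.Chart) : c.isBasisOver.degree ≤ m := by
  by_contra! hlt
  obtain ⟨T, hT, g, θ, a, hθ, ha⟩ := exists_generic_point c.isAffineOpen c.isBasisOver
  have hρ := toFunctionField_injective c.U
  have : IsDomain Γ((Over.mk c.U.ι).left, ⊤) := hρ.isDomain _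
  have : IsDomain Γ(T.left, ⊤) := θ.injective.isDomain θ.toRingHom
  refine exteriorPower.ιMulti_ne_zero (c.isBasisOver.basis g)
    (v := fun i : Fin (m + 1) => a ^ (i : ℕ)) ?_ (h T a)
  rw [Fintype.linearIndependent_iff]
  intro y hy
  set p : Γ(T.left, ⊤)[X] := ∑ i : Fin (m + 1), Polynomial.monomial (i : ℕ) (y i) with hp
  have h1 : aeval a p = 0 := by
    rw [hp, map_sum, ← hy]
    refine Finset.sum_congr rfl fun i _ => ?_
    rw [aeval_monomial, ← Algebra.smul_def]
  have h2 : p.degree < c.isBasisOver.degree := by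
    refine (degree_sum_le _ _).trans_lt ((Finset.sup_lt_iff (WithBot.bot_lt_coe _)).2 fun i _ => ?_)
    refine (degree_monomial_le _ _).trans_lt ?_
    exact_mod_cast i.2.trans_le hlt
  have h3 := IsGenericDet.eq_zero_of_degree_lt hρ _
    ((aeval_eq_zero_iff_aeval_generic c.isBasisOver hθ ha p).1 h1) (degree_map_le.trans_lt h2)
  rw [Polynomial.map_eq_zero_iff θ.injective] at h3
  intro i
  have h4 := congrArg (fun q => q.coeff (i : ℕ)) h3
  simpa [hp, finsetSum_coeff, coeff_monomial, Fin.val_inj] using h4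

lemma deg_eq_degree (hS : ∀ s : S, IsIntegrallyClosed (S.presheaf.stalk s))
    (hA : ∀ s : S, ∃ c : A.Chart, s ∈ c.U) (c : A.Chart) : c.isBasisOver.degree = A.deg := by
  obtain ⟨δ, hδ⟩ := exists_isLocallyGenericDet hS hA
  have h1 : A.DegLE c.isBasisOver.degree := by
    refine hδ.degLE hA fun c' => ?_
    obtain ⟨F, hF, -⟩ := hδ c
    obtain ⟨F', hF', -⟩ := hδ c'
    exact (degree_eq_and_eval₂_eq c'.isBasisOver c.isBasisOver hF' hF).1
  refine le_antisymm ?_ (Nat.sInf_le h1)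
  exact DegLE.degree_le (Nat.sInf_mem (s := {m | A.DegLE m}) ⟨_, h1⟩) c

end Degree

/-! ### Existence and uniqueness of the determinant -/

section Determinant

variable [IsIntegral S] {δ δ' : Γ(A.X.left, ⊤)}

lemma IsLocallyGenericDet.isDeterminant (hS : ∀ s : S, IsIntegrallyClosed (S.presheaf.stalk s))
    (hA : ∀ s : S, ∃ c : A.Chart, s ∈ c.U) (hδ : A.IsLocallyGenericDet δ) : A.IsDeterminant δ where
  isSymSection := hδ.isSymSection (deg_eq_degree hS hA)
  isMonoidHom := hδ.isMonoidHom hA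
  aeval_charPoly := hδ.aeval_charPoly hA

/-- In a chart, the conditions on a determinant at the universal point force it to be the generic
determinant. -/
lemma IsDeterminant.isLocallyGenericDet (hS : ∀ s : S, IsIntegrallyClosed (S.presheaf.stalk s))
    (hA : ∀ s : S, ∃ c : A.Chart, s ∈ c.U) (hδ : A.IsDeterminant δ) : A.IsLocallyGenericDet δ := by
  intro c
  set hB := c.isBasisOver with hB_def
  obtain ⟨F, hF⟩ := hB.exists_isGenericDet hS c.isAffineOpen
  obtain ⟨F', hF', hval'⟩ := hδ.isSymSection c.U c.isAffineOpen c.n c.e hB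
  have hval : ∀ (T : Over S) (g : T ⟶ Over.mk c.U.ι) (a : A.Pt T),
      a.val δ = F'.eval₂ (funHom g) ((hB.basis g).repr a) := by
    intro T g a
    conv_lhs => rw [← hB.sum_repr g a]
    exact hval' T g _
  obtain rfl : F' = F := by
    refine hF.eq_of_aeval_shift (u := hB.unitCoord) ?_ ?_ ?_
    · rw [← deg_eq_degree hS hA c] at hF'
      exact hF'
    · have h1 := (hδ.isMonoidHom (Over.mk c.U.ι)).1
      rw [hval _ (𝟙 _), funHom_id] at h1
      exact h1
    · obtain ⟨T, hT, g, θ, a, hθ, ha⟩ := exists_generic_point c.isAffineOpen hB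
      have h1 := (aeval_eq_zero_iff_aeval_generic hB hθ ha _).1 (hδ.aeval_charPoly T a)
      rw [charPoly_eq_shift hB hval T g a, shift_map] at h1
      have h2 : θ.toRingHom.comp (funHom g) = MvPolynomial.C := RingHom.ext hθ
      have h3 : (fun i => θ.toRingHom ((hB.basis g).repr a i)) = MvPolynomial.X := funext ha
      have h4 : (fun i => θ.toRingHom (funHom g (hB.unitCoord i))) =
          fun i => MvPolynomial.C (hB.unitCoord i) := funext fun i => hθ _
      rwa [h2, h3, h4] at h1
  exact ⟨F', hF, hval⟩

/-- Two such functions have the same value at the universal point of `A`, the identity. -/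
lemma IsLocallyGenericDet.unique (hA : ∀ s : S, ∃ c : A.Chart, s ∈ c.U)
    (hδ : A.IsLocallyGenericDet δ) (hδ' : A.IsLocallyGenericDet δ') : δ = δ' := by
  refine fun_ext_of_chart hA (T := A.X) _ _ fun T _ k c g => ?_
  obtain ⟨F, hF, hval⟩ := hδ c
  obtain ⟨F', hF', hval'⟩ := hδ' c
  obtain rfl : F = F' := MvPolynomial.map_injective _ hF.injective (hF.map_eq.trans hF'.map_eq.symm)
  exact (hval T g k).trans (hval' T g k).symm

/-- Being a determinant and being locally the generic determinant are the same property. -/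
theorem existsUnique_isDeterminant (hS : ∀ s : S, IsIntegrallyClosed (S.presheaf.stalk s))
    (hA : ∀ s : S, ∃ c : A.Chart, s ∈ c.U) : ∃! δ : Γ(A.X.left, ⊤), A.IsDeterminant δ := by
  obtain ⟨δ, hδ⟩ := exists_isLocallyGenericDet hS hA
  exact ⟨δ, hδ.isDeterminant hS hA, fun δ' hδ' =>
    (hδ'.isLocallyGenericDet hS hA).unique hA hδ⟩

end Determinant

end GaAlgebraScheme

/-! ### The opposite algebra scheme -/

namespace GaAlgebraScheme

variable {S : Scheme.{u}} {A : GaAlgebraScheme S}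

open Polynomial

section Opposite

/-- The identity of `A(T)`, as a linear map to the points of the opposite algebra scheme. -/
def toOp (A : GaAlgebraScheme S) (T : Over S) : A.Pt T ≃ₗ[Γ(T.left, ⊤)] A.op.Pt T where
  toFun a := a
  invFun a := a
  map_add' _ _ := rfl
  map_smul' _ _ := rfl
  left_inv _ := rfl
  right_inv _ := rfl

lemma toOp_mul {T : Over S} (a b : A.Pt T) : A.toOp T (a * b) = A.toOp T b * A.toOp T a := rfl

lemma toOp_one {T : Over S} : A.toOp T 1 = 1 := rfl

lemma toOp_pow {T : Over S} (a : A.Pt T) (k : ℕ) : A.toOp T (a ^ k) = A.toOp T a ^ k := by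
  induction k with
  | zero => rw [pow_zero, pow_zero, toOp_one]
  | succ k ih => rw [pow_succ, toOp_mul, ih, pow_succ']

lemma toOp_aeval {T : Over S} (a : A.Pt T) (p : Γ(T.left, ⊤)[X]) :
    A.toOp T (aeval a p) = aeval (A.toOp T a) p := by
  simp only [aeval_eq_sum_range, map_sum, map_smul, toOp_pow]

/-- The powers of an element are the same in the opposite algebra. -/
lemma op_degLE (m : ℕ) : A.op.DegLE m ↔ A.DegLE m := by
  constructor
  · intro h T _ a
    have h1 := congrArg (exteriorPower.map (m + 1) (A.toOp T).symm.toLinearMap) (h T (A.toOp T a))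
    simp only [exteriorPower.map_apply_ιMulti, map_zero, ← toOp_pow] at h1
    exact h1
  · intro h T _ a
    have h1 := congrArg (exteriorPower.map (m + 1) (A.toOp T).toLinearMap)
      (h T ((A.toOp T).symm a))
    rw [exteriorPower.map_apply_ιMulti, map_zero] at h1
    rw [← h1]
    congr 1

lemma op_deg : A.op.deg = A.deg := by
  simp only [deg, op_degLE]

lemma op_charPoly (δ : Γ(A.X.left, ⊤)) (T : Over S) [IsAffine T.left] (a : A.Pt T) :
    A.op.charPoly δ T (A.toOp T a) = A.charPoly δ T a := by
  have h := map_sub (A.toOp (line T))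
    (algebraMap Γ((line T).left, ⊤) (A.Pt (line T)) ((lineFun T).symm Polynomial.X))
    (a.pull (lineProj T))
  exact congrArg (fun b : A.op.Pt (line T) => lineFun T (b.val δ)) h.symm

lemma IsOfDim.op {n : ℕ} (hA : A.IsOfDim n) : A.op.IsOfDim n := hA

lemma IsSymSection.op {m : ℕ} {δ : Γ(A.X.left, ⊤)} (h : A.IsSymSection m δ) :
    A.op.IsSymSection m δ := h

lemma IsDeterminant.op {δ : Γ(A.X.left, ⊤)} (hδ : A.IsDeterminant δ) : A.op.IsDeterminant δ where
  isSymSection := by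
    rw [op_deg]
    exact hδ.isSymSection.op
  isMonoidHom T := ⟨(hδ.isMonoidHom T).1, fun a b =>
    ((hδ.isMonoidHom T).2 b a).trans (mul_comm _ _)⟩
  aeval_charPoly T _ a := by
    obtain ⟨a, rfl⟩ := (A.toOp T).surjective a
    rw [op_charPoly, ← toOp_aeval, hδ.aeval_charPoly T a, map_zero]

lemma IsDeterminant.det_eq {δ : Γ(A.X.left, ⊤)} (h : ∃! δ, A.IsDeterminant δ)
    (hδ : A.IsDeterminant δ) : A.det = δ := by
  rw [det, dif_pos h.exists]
  exact h.unique h.exists.choose_spec hδ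

end Opposite

end GaAlgebraScheme

theorem proposition4p1 (S : Scheme.{u}) [IsIntegral S]
    (hS : ∀ s : S, IsIntegrallyClosed (S.presheaf.stalk s))
    (n : ℕ) (hn : 2 ≤ n) (A : GaAlgebraScheme S) (hA : A.IsOfDim n) :
    (∃! δ : Γ(A.X.left, ⊤), A.IsDeterminant δ) ∧
    (∃! δ : Γ(A.op.X.left, ⊤), A.op.IsDeterminant δ) ∧
    A.op.det = A.det := by
  have h := GaAlgebraScheme.existsUnique_isDeterminant hS hA.exists_chart
  have h' := GaAlgebraScheme.existsUnique_isDeterminant hS hA.op.exists_chart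
  refine ⟨h, h', ?_⟩
  obtain ⟨δ, hδ, -⟩ := id h
  rw [GaAlgebraScheme.IsDeterminant.det_eq h hδ]
  exact GaAlgebraScheme.IsDeterminant.det_eq h' hδ.op
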